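/- Let $k$ be an algebraically closed field, and let the circle $S^1$ carry its usual topology and its anticlockwise cyclic order, so that $x_0<x_1<\dots<x_n$ means that the points are met in this order when moving anticlockwise once around the circle, and $[a,b]$, $(a,b)$ denote the closed and open arcs from $a$ anticlockwise to $b$. Let $\mathscr Z\subset S^1$ be admissible: $\mathscr Z$ is infinite, $\mathscr Z$ is discrete (each $z\in\mathscr Z$ has an open neighbourhood containing no other point of $\mathscr Z$), and each $x\in S^1$ that is the limit of a sequence from $\mathscr Z$ is the limit of both a (weakly) increasing and a (weakly) decreasing sequence from $\mathscr Z$. Each $z\in\mathscr Z$ then has a unique successor $z^+$ and a unique predecessor $z^-$ in $\mathscr Z\setminus\{z\}$, i.e. $(z,z^+)\cap\mathscr Z=\varnothing=(z^-,z)\cap\mathscr Z$. A diagonal of $\mathscr Z$ is a subset $\{x_0,x_1\}\subset\mathscr Z$ with $x_1\notin\{x_0^-,x_0,x_0^+\}$. The Igusa--Todorov cluster category $\mathscr C(\mathscr Z)$ is the following additive category. Let $R=k[[t]]$. Let $R\mathscr Z$ be the $R$-linear category with object set $\mathscr Z$, with each $\operatorname{Hom}(x,y)=R\,f_{xy}$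 free of rank one, and with $f_{yz}\circ f_{xy}=t^{c(x,y,z)}f_{xz}$, where $c(x,y,z)=0$ if $x=y$ or $y=z$ or $x<y<z$, and $c(x,y,z)=1$ otherwise. Let $\mathscr F$ be the category of pairs $(P,d)$, where $P$ is a finite formal direct sum of objects of $R\mathscr Z$ and $d\colon P\to P$ satisfies $d^2=t\cdot\mathrm{id}_P$ and factors through the canonical morphism $\eta_P\colon P\to P^+$, the diagonal morphism that is $f_{x,x^+}$ on each summand $x$ of $P$; morphisms of $\mathscr F$ are the morphisms of the objects $P$ that commute with $d$. For $x\ne y$ in $\mathscr Z$ let $M(x,y)=\bigl(x\oplus y,\ \begin{pmatrix}0&f_{yx}\\ f_{xy}&0\end{pmatrix}\bigr)\in\mathscr F$. Then $\mathscr C(\mathscr Z)$ is the quotient of $\mathscr F$ by the morphisms that factor through a finite direct sum of objects $M(x,x^+)$, $x\in\mathscr Z$ (the projective-injective objects). For a set $\mathscr X$ of diagonals of $\mathscr Z$, let $E(\mathscr X)$ be the set of the objects $M(x_0,x_1)$ of $\mathscr C(\mathscr Z)$ with $\{x_0,x_1\}\in\mathscr X$, and let $\operatorname{add}E(\mathscr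 X)$ be the smallest full subcategory of $\mathscr C(\mathscr Z)$ that contains $E(\mathscr X)$ and is closed under isomorphisms, finite direct sums and direct summands. A full subcategory $\mathscr D$ of $\mathscr C(\mathscr Z)$ is precovering if for each object $T$ of $\mathscr C(\mathscr Z)$ there is a morphism $f\colon D\to T$ with $D\in\mathscr D$ such that each morphism $D'\to T$ with $D'\in\mathscr D$ factors through $f$. For a sequence $(z_i)_{i\geqslant 0}$ from $\mathscr Z$ and a point $p$ of the closure of $\mathscr Z$, say that $z_i\to p$ from below (respectively, from above) if $z_i$ converges to $p$ and there is a $\mu\in S^1\setminus\{p\}$ such that $z_i\in[\mu,p]$ (respectively, $z_i\in[p,\mu]$) from some step. Consider the following conditions on a set $\mathscr X$ of diagonals of $\mathscr Z$. PC1: For all $p\neq q$, if there is a sequence $\{x^i_0,x^i_1\}_{i\geqslant 0}$ from $\mathscr X$ with $x^i_0\to p$ from below and $x^i_1\to q$ from below, then there is a sequence $\{x'^i_0,x'^i_1\}_{i\geqslant 0}$ from $\mathscr X$ with $x'^i_0\to p$ from above and $x'^i_1\to q$ from above. PC2: For all $p\neq q$, if there is a sequence $\{x^i_0,x^i_1\}_{i\geqslant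 0}$ from $\mathscr X$ with $x^i_0\to p$ from below and $x^i_1\to q$ from above, then there is a sequence $\{x'^i_0,x'^i_1\}_{i\geqslant 0}$ from $\mathscr X$ with $x'^i_0\to p$ from above and $x'^i_1\to q$ from above. Theorem. Let $\mathscr X$ be a set of diagonals of $\mathscr Z$. Then $\operatorname{add}E(\mathscr X)$ is a precovering subcategory of $\mathscr C(\mathscr Z)$ if and only if $\mathscr X$ satisfies conditions PC1 and PC2. -/

import Mathlib

open CategoryTheory CategoryTheory.Limits Filter Topology

noncomputable section

namespace IgusaTodorov

/-! ### Admissible subsets of the circle, and diagonals -/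

/-- The circle, as `ℝ / ℤ`, with its topology and its cyclic order in the positive direction:
`sbtw a b c` means `a < b < c`, i.e. the three points are distinct and met in this order. -/
abbrev S1 : Type := AddCircle (1 : ℝ)

/-- Admissible subsets `Z` of the circle: `Z` is infinite, `Z` is discrete, and every limit `x` of a
sequence from `Z` is the limit of an increasing sequence from `Z` (`z i ≤ z j ≤ x` for `i ≤ j`)
and of a decreasing one (`x ≤ z j ≤ z i` for `i ≤ j`). For `x ∈ Z` constant sequences do. -/
structure IsAdmissible (Z : Set S1) : Prop where
  infinite : Z.Infinite
  discrete : ∀ z ∈ Z, ∃ U : Set S1, IsOpen U ∧ z ∈ U ∧ ∀ w ∈ Z, w ∈ U → w = z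
  increasing : ∀ x ∈ closure Z, ∃ z : ℕ → S1, (∀ i, z i ∈ Z) ∧ Tendsto z atTop (𝓝 x) ∧
    ∀ i j, i ≤ j → btw (z i) (z j) x
  decreasing : ∀ x ∈ closure Z, ∃ z : ℕ → S1, (∀ i, z i ∈ Z) ∧ Tendsto z atTop (𝓝 x) ∧
    ∀ i j, i ≤ j → btw x (z j) (z i)

/-- `w = z⁺`, equivalently `z = w⁻`: the points `z ≠ w` of `Z` satisfy `(z, w) ∩ Z = ∅`.
In an admissible set every point has exactly one successor and exactly one predecessor. -/
def IsSucc (Z : Set S1) (z w : Z) : Prop :=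
  z ≠ w ∧ ∀ u : Z, ¬ sbtw (z : S1) (u : S1) (w : S1)

/-- Diagonals of `Z`: two-element subsets `{x, y}` of `Z` with `y ∉ {x⁻, x, x⁺}`. -/
def IsDiagonal (Z : Set S1) (e : Sym2 Z) : Prop :=
  ∀ x y : Z, e = s(x, y) → x ≠ y ∧ ¬ IsSucc Z x y ∧ ¬ IsSucc Z y x

/-- `z i → p` from below: eventually `z i ∈ [μ, p]`, for some `μ ≠ p`. -/
def TendstoBelow (z : ℕ → S1) (p : S1) : Prop :=
  Tendsto z atTop (𝓝 p) ∧ ∃ μ : S1, μ ≠ p ∧ ∀ᶠ i in atTop, z i ∈ Set.cIcc μ p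

/-- `z i → p` from above: eventually `z i ∈ [p, ν]`, for some `ν ≠ p`. -/
def TendstoAbove (z : ℕ → S1) (p : S1) : Prop :=
  Tendsto z atTop (𝓝 p) ∧ ∃ ν : S1, ν ≠ p ∧ ∀ᶠ i in atTop, z i ∈ Set.cIcc p ν

/-- Condition PC1 on a set of diagonals. -/
def PC1 (Z : Set S1) (X : Set (Sym2 Z)) : Prop :=
  ∀ p q : S1, p ≠ q →
    (∃ x₀ x₁ : ℕ → Z, (∀ i, s(x₀ i, x₁ i) ∈ X) ∧
      TendstoBelow (fun i => (x₀ i : S1)) p ∧ TendstoBelow (fun i => (x₁ i : S1)) q) →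
    ∃ x₀ x₁ : ℕ → Z, (∀ i, s(x₀ i, x₁ i) ∈ X) ∧
      TendstoAbove (fun i => (x₀ i : S1)) p ∧ TendstoAbove (fun i => (x₁ i : S1)) q

/-- Condition PC2 on a set of diagonals. -/
def PC2 (Z : Set S1) (X : Set (Sym2 Z)) : Prop :=
  ∀ p q : S1, p ≠ q →
    (∃ x₀ x₁ : ℕ → Z, (∀ i, s(x₀ i, x₁ i) ∈ X) ∧
      TendstoBelow (fun i => (x₀ i : S1)) p ∧ TendstoAbove (fun i => (x₁ i : S1)) q) →
    ∃ x₀ x₁ : ℕ → Z, (∀ i, s(x₀ i, x₁ i) ∈ X) ∧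
      TendstoAbove (fun i => (x₀ i : S1)) p ∧ TendstoAbove (fun i => (x₁ i : S1)) q

/-! ### The linearization of the cyclically ordered set `Z` over `R = k⟦t⟧` -/

open Classical in
/-- The cocycle of the cyclic order: going from `x` forward to `y` and then forward to `z` is going
from `x` forward to `z`, plus `cocycle x y z` full turns. -/
def cocycle (x y z : S1) : ℕ := if x = y ∨ y = z ∨ sbtw x y z then 0 else 1

/-- The cocycle identity. -/
theorem cocycle_add (x y z w : S1) :
    cocycle x y z + cocycle x z w = cocycle x y w + cocycle y z w := by
  have tot (a b c : S1) : a = b ∨ b = c ∨ c = a ∨ sbtw a b c ∨ sbtw c b a := by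
    rcases em (btw a b c) with h | h
    · rcases em (btw c b a) with h' | h'
      · rcases btw_antisymm h h' with h | h | h <;> simp [h]
      · simp [sbtw_of_btw_not_btw h h']
    · simp [sbtw_iff_not_btw.2 h]
  have asym (a b c : S1) (h : sbtw a b c) : ¬ sbtw c b a := sbtw_asymm h
  have cyc (a b c : S1) (h : sbtw a b c) : sbtw b c a := sbtw_cyclic_left h
  have irr (a b : S1) : ¬ sbtw a b a := sbtw_irrefl_left_right
  have tr (a b c d : S1) (h : sbtw a b c) (h' : sbtw b d c) : sbtw a d c := sbtw_trans_left h h'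
  unfold cocycle
  have t1 := tot x y z
  have t2 := tot x z w
  have t3 := tot x y w
  have t4 := tot y z w
  grind

/-- The objects of the linearization of `Z`: the points of `Z`. -/
@[ext]
structure Pt (k : Type*) (Z : Set S1) where
  /-- the underlying point -/
  pt : Z

variable {k : Type*} [Field k] {Z : Set S1}

/-- The linearization of `Z`: each hom-set is a free `k⟦t⟧`-module of rank one with a standard
generator `1`, and the composite of the generators `x ⟶ y` and `y ⟶ z` is `t ^ cocycle x y z`
times the generator `x ⟶ z`. -/
instance : Category (Pt k Z) where
  Hom _ _ := PowerSeries k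
  id _ := 1
  comp {x y z} f g := PowerSeries.X ^ cocycle x.pt y.pt z.pt * (f * g)
  id_comp f := by simp [cocycle]
  comp_id f := by simp [cocycle]
  assoc {x y z w} f g h := by
    have := congrArg (fun n => (PowerSeries.X : PowerSeries k) ^ n)
      (cocycle_add (x.pt : S1) y.pt z.pt w.pt)
    simp only [pow_add] at this
    linear_combination (f * g * h) * this

instance (x y : Pt k Z) : AddCommGroup (x ⟶ y) := inferInstanceAs (AddCommGroup (PowerSeries k))

instance (x y : Pt k Z) : Module (PowerSeries k) (x ⟶ y) :=
  inferInstanceAs (Module (PowerSeries k) (PowerSeries k))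

/-- The standard generator of `x ⟶ y`. -/
def gen (x y : Pt k Z) : x ⟶ y := (1 : PowerSeries k)

instance : Preadditive (Pt k Z) where
  add_comp x y z f f' g := by
    have key (a f f' g : PowerSeries k) : a * ((f + f') * g) = a * (f * g) + a * (f' * g) := by ring
    exact key _ _ _ _
  comp_add x y z f g g' := by
    have key (a f g g' : PowerSeries k) : a * (f * (g + g')) = a * (f * g) + a * (f * g') := by ring
    exact key _ _ _ _

theorem gen_comp_gen (x y z : Pt k Z) :
    gen x y ≫ gen y z = (PowerSeries.X : PowerSeries k) ^ cocycle x.pt y.pt z.pt • gen x z := by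
  have key (a : PowerSeries k) : a * (1 * 1) = a * 1 := by ring
  exact key _

/-! ### The Frobenius category of `Z` -/

variable (k Z) in
/-- Objects of the Frobenius category: pairs `(P, d)` of a finitely generated projective `P` over
the linearization of `Z` (a finite direct sum of points of `Z`) and an endomorphism `d` of `P` with
`d ^ 2 = t`, such that `d` factors through the canonical map `η : P ⟶ P⁺`. Here `P⁺` replaces
each summand `x` of `P` by `x⁺`, and `η` is diagonal, with the generators `x ⟶ x⁺` as its
entries; so `d` factors through `η` if and only if each entry `x ⟶ y` of `d` factors through the
generator `x ⟶ x⁺`. -/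
structure Frob where
  /-- the projective -/
  P : Mat_ (Pt k Z)
  /-- the endomorphism -/
  d : P ⟶ P
  d_sq : ∀ i j, (d ≫ d) i j = (PowerSeries.X : PowerSeries k) • (𝟙 P : P ⟶ P) i j
  twisted : ∀ (i j : P.ι) (w : Pt k Z), IsSucc Z (P.X i).pt w.pt →
    ∃ g : w ⟶ P.X j, d i j = gen (P.X i) w ≫ g

namespace Frob

/-- Morphisms of the Frobenius category: those that commute with `d`. -/
@[ext]
structure Hom (A B : Frob k Z) where
  /-- the underlying morphism -/
  f : A.P ⟶ B.P
  comm : A.d ≫ f = f ≫ B.d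

instance : Category (Frob k Z) where
  Hom := Hom
  id A := ⟨𝟙 A.P, by simp⟩
  comp u v := ⟨u.f ≫ v.f, by rw [← Category.assoc, u.comm, Category.assoc, v.comm,
    Category.assoc]⟩
  id_comp u := Hom.ext (Category.id_comp u.f)
  comp_id u := Hom.ext (Category.comp_id u.f)
  assoc u v w := Hom.ext (Category.assoc u.f v.f w.f)

variable {A B C : Frob k Z}

@[ext]
theorem hom_ext {u v : A ⟶ B} (h : u.f = v.f) : u = v := Hom.ext h

@[simp]
theorem id_f (A : Frob k Z) : (𝟙 A : A ⟶ A).f = 𝟙 A.P := rfl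

@[simp]
theorem comp_f (u : A ⟶ B) (v : B ⟶ C) : (u ≫ v).f = u.f ≫ v.f := rfl

instance : Zero (A ⟶ B) := ⟨⟨0, by simp⟩⟩

instance : Add (A ⟶ B) := ⟨fun u v => ⟨u.f + v.f, by simp [u.comm, v.comm]⟩⟩

instance : Neg (A ⟶ B) := ⟨fun u => ⟨-u.f, by simp [u.comm]⟩⟩

@[simp]
theorem zero_f : (0 : A ⟶ B).f = 0 := rfl

@[simp]
theorem add_f (u v : A ⟶ B) : (u + v).f = u.f + v.f := rfl

@[simp]
theorem neg_f (u : A ⟶ B) : (-u).f = -u.f := rfl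

instance : AddCommGroup (A ⟶ B) where
  add_assoc u v w := by ext1; simp [add_assoc]
  zero_add u := by ext1; simp
  add_zero u := by ext1; simp
  add_comm u v := by ext1; simp [add_comm]
  neg_add_cancel u := by ext1; simp
  nsmul := nsmulRec
  zsmul := zsmulRec

instance : Preadditive (Frob k Z) where
  add_comp _ _ _ u v w := by ext1; simp
  comp_add _ _ _ u v w := by ext1; simp

variable (k) in
/-- The sum of two points `x` and `y`. -/
abbrev pairP (x y : Z) : Mat_ (Pt k Z) where
  ι := Bool
  X := fun b => ⟨bif b then y else x⟩

variable (k) in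
/-- The endomorphism of the sum of `x` and `y` given by the generators `x ⟶ y` and `y ⟶ x`. -/
def pairD (x y : Z) : pairP k x y ⟶ pairP k x y :=
  fun i j => match i, j with
    | false, true => gen ⟨x⟩ ⟨y⟩
    | true, false => gen ⟨y⟩ ⟨x⟩
    | false, false => 0
    | true, true => 0

variable (k) in
/-- The object `M(x, y)`: the sum of the two points `x ≠ y` of `Z`, with `d` given by the
generators `x ⟶ y` and `y ⟶ x`. -/
def M (x y : Z) (h : x ≠ y) : Frob k Z where
  P := pairP k x y
  d := pairD k x y
  d_sq := by
    have hc (a b : Z) (hab : a ≠ b) : cocycle (a : S1) b a = 1 := by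
      simp [cocycle, Subtype.coe_injective.ne hab, Subtype.coe_injective.ne hab.symm,
        sbtw_irrefl_left_right]
    have hg (a b : Z) (hab : a ≠ b) :
        gen (k := k) ⟨a⟩ ⟨b⟩ ≫ gen ⟨b⟩ ⟨a⟩ = (PowerSeries.X : PowerSeries k) • 𝟙 _ := by
      rw [gen_comp_gen, hc a b hab, pow_one]
      rfl
    have hs (i j : Bool) : (pairD k x y ≫ pairD k x y) i j =
        pairD k x y i true ≫ pairD k x y true j + pairD k x y i false ≫ pairD k x y false j := by
      rw [Mat_.comp_apply]
      exact Fintype.sum_bool _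
    rintro (_ | _) (_ | _)
    · rw [Mat_.id_apply_self, hs]
      refine Eq.trans ?_ (hg x y h)
      change gen _ _ ≫ gen _ _ + (0 : (⟨x⟩ : Pt k Z) ⟶ ⟨x⟩) ≫ (0 : (⟨x⟩ : Pt k Z) ⟶ ⟨x⟩) = _
      rw [comp_zero, add_zero]
      rfl
    · rw [Mat_.id_apply_of_ne _ _ _ Bool.false_ne_true, hs, smul_zero]
      change gen _ _ ≫ (0 : (⟨y⟩ : Pt k Z) ⟶ ⟨y⟩) + (0 : (⟨x⟩ : Pt k Z) ⟶ ⟨x⟩) ≫ gen _ _ = _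
      rw [comp_zero, zero_comp, add_zero]
    · rw [Mat_.id_apply_of_ne _ _ _ Bool.false_ne_true.symm, hs, smul_zero]
      change (0 : (⟨y⟩ : Pt k Z) ⟶ ⟨y⟩) ≫ gen _ _ + gen _ _ ≫ (0 : (⟨x⟩ : Pt k Z) ⟶ ⟨x⟩) = _
      rw [comp_zero, zero_comp, add_zero]
    · rw [Mat_.id_apply_self, hs]
      refine Eq.trans ?_ (hg y x h.symm)
      change (0 : (⟨y⟩ : Pt k Z) ⟶ ⟨y⟩) ≫ (0 : (⟨y⟩ : Pt k Z) ⟶ ⟨y⟩) + gen _ _ ≫ gen _ _ = _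
      rw [comp_zero, zero_add]
      rfl
  twisted := by
    have hg (a b : Z) (hab : a ≠ b) (w : Pt k Z) (hw : IsSucc Z a w.pt) :
        gen (k := k) ⟨a⟩ ⟨b⟩ = gen ⟨a⟩ w ≫ gen w ⟨b⟩ := by
      rw [gen_comp_gen]
      have hc : cocycle (a : S1) w.pt b = 0 := by
        by_cases hwb : w.pt = b
        · simp [cocycle, hwb]
        · have h₁ := hw.2 b
          rw [sbtw_iff_not_btw, not_not] at h₁
          simp only [cocycle, ite_eq_left_iff, one_ne_zero, imp_false, not_not]
          refine Or.inr (Or.inr (sbtw_iff_not_btw.2 fun h₃ => ?_))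
          rcases btw_antisymm h₁ h₃.cyclic_right with h₄ | h₄ | h₄
          · exact hwb (Subtype.ext h₄)
          · exact hab (Subtype.ext h₄.symm)
          · exact hw.1 (Subtype.ext h₄)
      rw [hc, pow_zero, one_smul]
    rintro (_ | _) (_ | _) w hw
    · exact ⟨0, comp_zero.symm⟩
    · exact ⟨gen _ _, hg x y h w hw⟩
    · exact ⟨gen _ _, hg y x h.symm w hw⟩
    · exact ⟨0, comp_zero.symm⟩

/-- The projective-injective objects of the Frobenius category are the finite direct sums of the
objects `M(x, x⁺)`. The subgroup `null A B` consists of the finite sums of morphisms that factor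
through some `M(x, x⁺)`, i.e. of the morphisms that factor through a projective-injective. -/
def null (A B : Frob k Z) : AddSubgroup (A ⟶ B) :=
  AddSubgroup.closure {u | ∃ (x y : Z) (h : IsSucc Z x y) (v : A ⟶ M k x y h.1)
    (w : M k x y h.1 ⟶ B), u = v ≫ w}

variable (k Z) in
/-- Two morphisms are stably equal if their difference factors through a projective-injective. -/
def stableRel : HomRel (Frob k Z) := fun A B u v => u - v ∈ null A B

theorem comp_mem_null (u : A ⟶ B) {v : B ⟶ C} (hv : v ∈ null B C) : u ≫ v ∈ null A C := by
  induction hv using AddSubgroup.closure_induction with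
  | mem v hv =>
    obtain ⟨x, y, h, a, b, rfl⟩ := hv
    exact AddSubgroup.subset_closure ⟨x, y, h, u ≫ a, b, by simp⟩
  | zero => simp [zero_mem]
  | add v w _ _ hv hw => rw [Preadditive.comp_add]; exact add_mem hv hw
  | neg v _ hv => rw [Preadditive.comp_neg]; exact neg_mem hv

theorem mem_null_comp {u : A ⟶ B} (hu : u ∈ null A B) (v : B ⟶ C) : u ≫ v ∈ null A C := by
  induction hu using AddSubgroup.closure_induction with
  | mem u hu =>
    obtain ⟨x, y, h, a, b, rfl⟩ := hu
    exact AddSubgroup.subset_closure ⟨x, y, h, a, b ≫ v, by simp⟩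
  | zero => simp [zero_mem]
  | add v w _ _ hv hw => rw [Preadditive.add_comp]; exact add_mem hv hw
  | neg v _ hv => rw [Preadditive.neg_comp]; exact neg_mem hv

instance : Congruence (stableRel k Z) where
  equivalence :=
    { refl := fun u => by simp [stableRel, zero_mem]
      symm := fun {u v} h => by
        have := neg_mem h
        rwa [neg_sub] at this
      trans := fun {u v w} h h' => by
        have := add_mem h h'
        rwa [sub_add_sub_cancel] at this }
  comp_left u v w h := by
    unfold stableRel
    rw [← Preadditive.comp_sub]
    exact comp_mem_null u h
  comp_right u h := by
    unfold stableRel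
    rw [← Preadditive.sub_comp]
    exact mem_null_comp h u

end Frob

/-! ### The cluster category `C(Z)` -/

variable (k Z) in
/-- The cluster category `C(Z)`: the stable category of the Frobenius category of `Z`. -/
abbrev ClusterCat : Type _ := Quotient (Frob.stableRel k Z)

instance : Preadditive (ClusterCat k Z) :=
  Quotient.preadditive (Frob.stableRel k Z) fun _ _ f₁ f₂ g₁ g₂ hf hg => by
    have := add_mem hf hg
    rwa [sub_add_sub_comm] at this

variable (k) in
/-- The set `E(X)` of objects of `C(Z)` that correspond to the diagonals in `X`; the diagonal
`{x, y}` corresponds to (the isomorphism class of) `M(x, y) ≅ M(y, x)`. -/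
def E (X : Set (Sym2 Z)) : ObjectProperty (ClusterCat k Z) := fun T =>
  ∃ (x y : Z) (h : x ≠ y), s(x, y) ∈ X ∧ T = (Quotient.functor _).obj (Frob.M k x y h)

/-! ### Additive and precovering subcategories -/

section

universe v u

variable {C : Type u} [Category.{v} C]

/-- Additive subcategories: full subcategories closed under isomorphisms, finite direct sums and
direct summands. -/
structure IsAdditiveSubcategory [Preadditive C] (P : ObjectProperty C) : Prop where
  of_iso : ∀ {S T : C}, (S ≅ T) → P S → P T
  of_sum : ∀ {n : ℕ} {S : Fin n → C} (b : Bicone S), b.IsBilimit → (∀ i, P (S i)) → P b.pt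
  of_summand : ∀ {S T : C} (b : BinaryBicone S T), b.IsBilimit → P b.pt → P S

/-- `add S`: the smallest additive subcategory that contains `S`. -/
def add [Preadditive C] (S : ObjectProperty C) : ObjectProperty C := fun T =>
  ∀ P : ObjectProperty C, IsAdditiveSubcategory P → (∀ U, S U → P U) → P T

/-- The morphism `f : x ⟶ t` is a `P`-precover of `t`. -/
def IsPrecover (P : ObjectProperty C) {x t : C} (f : x ⟶ t) : Prop :=
  P x ∧ ∀ (x' : C) (g : x' ⟶ t), P x' → ∃ h : x' ⟶ x, h ≫ f = g

/-- Precovering subcategories: every object has a precover. -/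
def IsPrecovering (P : ObjectProperty C) : Prop :=
  ∀ t : C, ∃ (x : C) (f : x ⟶ t), IsPrecover P f

end

end IgusaTodorov

end

/-! Sorting the diagonals near `(p, q)` by the side from which each end approaches shows that PC1
and PC2 together say the following: every limit `(p, q)`, `p ≠ q`, of diagonals in `X` is also a
limit of diagonals in `X` with both ends coming from above (`limitsFromAbove_iff`). The theorem is
proved for this condition.

Limits give precovers. A morphism `M(x₀, x₁) ⟶ T` factors through `M(y₀, y₁)` when `x₀` and `x₁`
move forward to `y₀` and `y₁`, keeping their relative order and passing no point of `T`
(`exists_factor`). Let `S` be a finite set containing the points of `T`. If both ends first meet the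
same point of `S`, one end can be pushed to the predecessor of the other, so the morphism is stably
zero (`mem_null_of_isFirst`). If they first meet `p ≠ q`, compactness of the torus and the limit
condition provide finitely many diagonals of `X`, one of which lies ahead of any given diagonal of
this type (`exists_finite_dominating`). Each of these has finitely generated morphisms to `T`,
because `k⟦t⟧` is noetherian, and the sum of all the generators is a precover.

Precovers give limits. Choose `y₀`, `y₁` at or just above `p`, `q`. Diagonals `{x₀, x₁}` of `X` near
`(p, q)` have a morphism to `M(y₀, y₁)` with leading coefficient one, and the leading coefficient is
a stable invariant (`lead_eq_zero_of_mem_null`). These morphisms factor through one precover, and a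
nonzero leading coefficient forces a diagonal from a finite subset of `X` to have its ends between
`x₀` and `y₀` and between `x₁` and `y₁` (`lead_comp_ne_zero`). By pigeonhole a single diagonal
serves arbitrarily near `(p, q)`; in the limit its ends lie between `p` and `y₀` and between `q` and
`y₁`. -/

noncomputable section

namespace IgusaTodorov

/-! ### Lengths of arcs -/

/-- The length, in `[0, 1)`, of the arc from `x` anticlockwise to `y`. -/
def arc (x y : S1) : ℝ := (AddCircle.equivIco (1 : ℝ) 0 (y - x) : ℝ)

theorem arc_nonneg (x y : S1) : 0 ≤ arc x y := (AddCircle.equivIco (1 : ℝ) 0 (y - x)).2.1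

theorem arc_lt_one (x y : S1) : arc x y < 1 :=
  (AddCircle.equivIco (1 : ℝ) 0 (y - x)).2.2.trans_eq (zero_add 1)

theorem coe_arc (x y : S1) : (arc x y : S1) = y - x :=
  AddCircle.coe_equivIco

theorem arc_eq_of_coe_eq {x y : S1} {r : ℝ} (h₀ : 0 ≤ r) (h₁ : r < 1) (h : (r : S1) = y - x) :
    arc x y = r := by
  have hr : r ∈ Set.Ico (0 : ℝ) (0 + 1) := ⟨h₀, by simpa using h₁⟩
  unfold arc
  rw [← h, AddCircle.equivIco_coe_eq hr]

theorem arc_self (x : S1) : arc x x = 0 := arc_eq_of_coe_eq le_rfl one_pos (by simp)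

theorem arc_eq_zero_iff {x y : S1} : arc x y = 0 ↔ x = y := by
  refine ⟨fun h => ?_, fun h => h ▸ arc_self x⟩
  have := coe_arc x y
  rw [h] at this
  exact (sub_eq_zero.1 (by simpa using this.symm)).symm

theorem arc_pos_iff {x y : S1} : 0 < arc x y ↔ x ≠ y := by
  rw [(arc_nonneg x y).lt_iff_ne, ne_comm, Ne, arc_eq_zero_iff]

theorem arc_add_arc (x y z : S1) :
    arc x y + arc y z = arc x z ∨ arc x y + arc y z = arc x z + 1 := by
  have h : ((arc x y + arc y z : ℝ) : S1) = z - x := by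
    rw [AddCircle.coe_add, coe_arc, coe_arc]; abel
  have h₀ := arc_nonneg x y
  have h₁ := arc_nonneg y z
  have h₂ := arc_lt_one x y
  have h₃ := arc_lt_one y z
  rcases lt_or_ge (arc x y + arc y z) 1 with h' | h'
  · exact Or.inl (arc_eq_of_coe_eq (by linarith) h' h).symm
  · right
    have : arc x z = arc x y + arc y z - 1 := by
      refine arc_eq_of_coe_eq (by linarith) (by linarith) ?_
      rw [AddCircle.coe_sub, h]
      simp
    linarith

/-- The length of an arc in terms of the positions of its ends relative to `b`. -/
theorem arc_eq_sub (b x y : S1) :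
    arc x y = arc b y - arc b x + if arc b y < arc b x then 1 else 0 := by
  have h₀ := arc_nonneg x y
  have h₁ := arc_lt_one x y
  rcases arc_add_arc b x y with h | h
  · rw [if_neg (by linarith)]; linarith
  · rw [if_pos (by linarith)]; linarith

theorem arc_injective (b : S1) {x y : S1} (h : arc b x = arc b y) : x = y := by
  rw [← arc_eq_zero_iff, arc_eq_sub b]
  simp [h]

theorem arc_left_injective (b : S1) {x y : S1} (h : arc x b = arc y b) : x = y := by
  have := arc_add_arc x y b
  have h₀ := arc_lt_one x y
  refine arc_eq_zero_iff.1 ?_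
  rcases this with h' | h' <;> linarith

/-- The second alternative is needed because `btw x y x` holds for every `y`, whereas `arc x x = 0`.
-/
theorem btw_iff_arc {x y z : S1} : btw x y z ↔ arc x y ≤ arc x z ∨ x = z := by
  induction x using QuotientAddGroup.induction_on with | H x =>
  induction y using QuotientAddGroup.induction_on with | H y =>
  induction z using QuotientAddGroup.induction_on with | H z =>
  rw [QuotientAddGroup.btw_coe_iff']
  have hy : arc x y = toIcoMod one_pos 0 (y - x) := rfl
  have hz : arc x z = toIcoMod one_pos 0 (z - x) := rfl
  have hz' : (x : S1) = z ↔ arc x z = 0 := arc_eq_zero_iff.symm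
  have hlt := arc_lt_one x y
  by_cases h : (x : S1) = z
  · have h₀ : arc x z = 0 := hz'.1 h
    -- The representative in `(0, 1]` of the zero class is `1`, so the comparison defining `btw`
    -- always holds here.
    have : toIocMod (one_pos : (0 : ℝ) < 1) 0 (z - x) = 1 := by
      have h1 : toIcoMod (one_pos : (0 : ℝ) < 1) 0 (z - x) = 0 := h₀
      have := (AddCommGroup.modEq_iff_toIcoMod_add_period_eq_toIocMod
        (hp := (one_pos : (0 : ℝ) < 1)) (a := (0 : ℝ)) (b := z - x)).1
      rw [← this, h1]
      · simp
      · exact (AddCommGroup.modEq_iff_toIcoMod_eq_left one_pos).2 h1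
    simp only [h, or_true, iff_true]
    rw [this]
    exact le_of_lt (by rw [← hy]; exact hlt)
  · have : toIocMod (one_pos : (0 : ℝ) < 1) 0 (z - x) = toIcoMod one_pos 0 (z - x) := by
      refine ((AddCommGroup.not_modEq_iff_toIcoMod_eq_toIocMod one_pos).1 fun hm => ?_).symm
      exact h (hz'.2 ((AddCommGroup.modEq_iff_toIcoMod_eq_left one_pos).1 hm))
    rw [this]
    simp only [h, or_false]
    rfl

theorem sbtw_iff_arc {x y z : S1} : sbtw x y z ↔ 0 < arc x y ∧ arc x y < arc x z := by
  rw [sbtw_iff_not_btw, btw_iff_arc, arc_eq_sub x z y, arc_eq_sub x z x, arc_self]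
  have h₀ := arc_nonneg x y
  have h₁ := arc_nonneg x z
  have h₂ := arc_lt_one x y
  have h₃ := arc_lt_one x z
  rw [← (show arc x z = arc x x ↔ z = x from ⟨arc_injective x, fun h => h ▸ rfl⟩), arc_self]
  constructor
  · intro h
    rw [not_or] at h
    obtain ⟨h, h'⟩ := h
    have : 0 < arc x z := lt_of_le_of_ne h₁ (Ne.symm h')
    rw [if_pos this] at h
    split_ifs at h with h₄
    · exact ⟨by_contra fun h5 => by linarith, h₄⟩
    · linarith
  · rintro ⟨h, h'⟩
    rw [if_pos h', if_pos (by linarith), not_or]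
    constructor <;> intro <;> linarith

/-- This turns divisibility by `t` into inequalities between arc lengths; with `arc_eq_sub`, cyclic
order arguments become linear arithmetic relative to a base point. -/
theorem cocycle_eq_zero_iff {x y z : S1} : cocycle x y z = 0 ↔ arc x y ≤ arc x z := by
  unfold cocycle
  simp only [ite_eq_left_iff, one_ne_zero, imp_false, not_not, sbtw_iff_arc]
  rw [← arc_eq_zero_iff (x := x)]
  have h₀ := arc_nonneg x y
  have h₁ := arc_nonneg x z
  constructor
  · rintro (h | h | h)
    · linarith
    · rw [h]
    · exact h.2.le
  · intro h
    rcases h.lt_or_eq with h | h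
    · rcases h₀.lt_or_eq with h' | h'
      · exact Or.inr (Or.inr ⟨h', h⟩)
      · exact Or.inl h'.symm
    · exact Or.inr (Or.inl (arc_injective x h))

section

variable {Z : Set S1}

/-! ### Arcs and the topology of the circle -/

/-- The only jump of `arc`, from `1` to `0`, is on the diagonal `p = q`. -/
theorem continuousAt_arc {p q : S1} (h : p ≠ q) :
    ContinuousAt (fun x : S1 × S1 => arc x.1 x.2) (p, q) := by
  have h₁ : ContinuousAt (AddCircle.equivIco (1 : ℝ) 0) (q - p) :=
    AddCircle.continuousAt_equivIco 1 0 (by simpa [sub_eq_zero] using h.symm)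
  have h₂ : ContinuousAt (fun x : S1 × S1 => x.2 - x.1) (p, q) := by fun_prop
  exact continuousAt_subtype_val.comp (ContinuousAt.comp (f := fun x : S1 × S1 => x.2 - x.1) h₁ h₂)

theorem continuousAt_arc_left {p q : S1} (h : p ≠ q) : ContinuousAt (fun x => arc x q) p :=
  ContinuousAt.comp (f := fun x : S1 => (x, q)) (continuousAt_arc h) (by fun_prop)

theorem continuousAt_arc_right {p q : S1} (h : p ≠ q) : ContinuousAt (fun x => arc p x) q :=
  ContinuousAt.comp (f := fun x : S1 => (p, x)) (continuousAt_arc h) (by fun_prop)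

theorem dist_eq_arc (x y : S1) : dist x y = min (arc x y) (1 - arc x y) := by
  rw [dist_comm, dist_eq_norm, ← coe_arc, UnitAddCircle.norm_eq, abs_sub_round_eq_min,
    Int.fract_eq_self.2 ⟨arc_nonneg x y, arc_lt_one x y⟩]

theorem arc_comm {x y : S1} (h : x ≠ y) : arc y x = 1 - arc x y := by
  rw [arc_eq_sub x y x, arc_self, if_pos (arc_pos_iff.2 h)]
  ring

theorem dist_le_arc (x y : S1) : dist x y ≤ arc x y :=
  (dist_eq_arc x y).trans_le (min_le_left _ _)

/-- On `[p, ν]` with `ν ≠ p` the complementary arc has length at least `1 - arc p ν`, so a smaller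
distance to `p` can only be `arc p (z i)` itself. -/
theorem tendstoAbove_iff {z : ℕ → S1} {p : S1} :
    TendstoAbove z p ↔ Tendsto (fun i => arc p (z i)) atTop (𝓝 0) := by
  constructor
  · rintro ⟨hz, ν, hν, h⟩
    rw [tendsto_iff_dist_tendsto_zero] at hz
    have hpos : (0 : ℝ) < 1 - arc p ν := by linarith [arc_lt_one p ν]
    refine hz.congr' ?_
    filter_upwards [h, hz.eventually_lt_const hpos] with i hi hi'
    have : arc p (z i) ≤ arc p ν := by
      rcases btw_iff_arc.1 (Set.mem_cIcc.1 hi) with h | h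
      · exact h
      · exact absurd h.symm hν
    rw [dist_comm, dist_eq_arc] at hi' ⊢
    refine min_eq_left (le_of_not_gt fun h' => ?_)
    rw [min_eq_right h'.le] at hi'
    linarith
  · intro h
    refine ⟨?_, p + (2⁻¹ : ℝ), ?_, ?_⟩
    · rw [tendsto_iff_dist_tendsto_zero]
      refine squeeze_zero (fun _ => dist_nonneg) (fun i => ?_) h
      rw [dist_comm]
      exact dist_le_arc _ _
    · have : arc p (p + (2⁻¹ : ℝ)) = 2⁻¹ := arc_eq_of_coe_eq (by norm_num) (by norm_num) (by simp)
      rw [ne_comm, ← arc_pos_iff, this]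
      norm_num
    · have : arc p (p + (2⁻¹ : ℝ)) = 2⁻¹ := arc_eq_of_coe_eq (by norm_num) (by norm_num) (by simp)
      filter_upwards [h.eventually_lt_const (show (0 : ℝ) < 2⁻¹ by norm_num)] with i hi
      rw [Set.mem_cIcc, btw_iff_arc, this]
      exact Or.inl hi.le

theorem tendstoAbove_of_arc_le {z : ℕ → S1} {p : S1} (hz : Tendsto z atTop (𝓝 p))
    (h : ∀ i, arc p (z i) ≤ 2⁻¹) : TendstoAbove z p := by
  rw [tendstoAbove_iff]
  rw [tendsto_iff_dist_tendsto_zero] at hz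
  refine hz.congr fun i => ?_
  rw [dist_comm, dist_eq_arc]
  exact min_eq_left (by linarith [h i])

theorem tendstoBelow_of_arc_le {z : ℕ → S1} {p : S1} (hz : Tendsto z atTop (𝓝 p))
    (h : ∀ i, arc (z i) p ≤ 2⁻¹) : TendstoBelow z p := by
  have hμ : arc (p - (2⁻¹ : ℝ)) p = 2⁻¹ := arc_eq_of_coe_eq (by norm_num) (by norm_num) (by simp)
  refine ⟨hz, p - (2⁻¹ : ℝ), ?_, Eventually.of_forall fun i => ?_⟩
  · rw [← arc_pos_iff, hμ]
    norm_num
  · rw [Set.mem_cIcc, btw_iff_arc]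
    left
    have := h i
    rw [arc_eq_sub (p - (2⁻¹ : ℝ)), hμ] at this
    rw [hμ]
    by_contra h'
    rw [if_pos (not_le.1 h')] at this
    linarith [arc_lt_one (p - (2⁻¹ : ℝ)) (z i)]

/-! ### Admissible sets -/

namespace IsAdmissible

theorem exists_arc_lt (hZ : IsAdmissible Z) {p : S1} (hp : p ∈ closure Z) {ε : ℝ} (hε : 0 < ε) :
    ∃ y : Z, arc p y < ε := by
  obtain ⟨z, hz, hlim, hmono⟩ := hZ.decreasing p hp
  -- The bound `ν` in `TendstoAbove` will be `z 0`, which has to differ from `p`; otherwise `z 0` is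
  -- already the required point.
  by_cases h₀ : z 0 = p
  · refine ⟨⟨z 0, hz 0⟩, ?_⟩
    change arc p (z 0) < ε
    rwa [h₀, arc_self]
  · have : TendstoAbove z p :=
      ⟨hlim, z 0, h₀, Eventually.of_forall fun i => hmono 0 i (Nat.zero_le i)⟩
    obtain ⟨i, hi⟩ := ((tendstoAbove_iff.1 this).eventually_lt_const hε).exists
    exact ⟨⟨z i, hz i⟩, hi⟩

theorem exists_arc_lt' (hZ : IsAdmissible Z) {p : S1} (hp : p ∈ closure Z) {ε : ℝ} (hε : 0 < ε) :
    ∃ y : Z, arc y p < ε := by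
  obtain ⟨z, hz, hlim, hmono⟩ := hZ.increasing p hp
  by_cases h₀ : z 0 = p
  · refine ⟨⟨z 0, hz 0⟩, ?_⟩
    change arc (z 0) p < ε
    rwa [h₀, arc_self]
  · have hpos : 0 < arc (z 0) p := arc_pos_iff.2 h₀
    rw [tendsto_iff_dist_tendsto_zero] at hlim
    -- The second bound excludes that the distance is the complementary arc, since `arc (z i) p ≤
    -- arc (z 0) p`.
    obtain ⟨i, hi⟩ := (hlim.eventually_lt_const
      (lt_min hε (show 0 < 1 - arc (z 0) p by linarith [arc_lt_one (z 0) p]))).exists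
    refine ⟨⟨z i, hz i⟩, ?_⟩
    change arc (z i) p < ε
    have hle : arc (z i) p ≤ arc (z 0) p := by
      have : arc (z 0) (z i) ≤ arc (z 0) p := by
        rcases btw_iff_arc.1 (hmono 0 i (Nat.zero_le i)) with h | h
        · exact h
        · exact absurd h h₀
      rw [arc_eq_sub (z 0), if_neg (by linarith)]
      linarith [arc_nonneg (z 0) (z i)]
    rw [dist_eq_arc, lt_min_iff, min_lt_iff, min_lt_iff] at hi
    rcases hi.1 with h | h
    · exact h
    · rcases hi.2 with h' | h' <;> by_contra <;> linarith [arc_lt_one (z i) p]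

theorem eventually_eq (hZ : IsAdmissible Z) {p : S1} (hp : p ∈ Z) :
    ∀ᶠ x in 𝓝 p, x ∈ Z → x = p := by
  obtain ⟨U, hU, hpU, h⟩ := hZ.discrete p hp
  filter_upwards [hU.mem_nhds hpU] with x hx hxZ using h x hxZ hx

/-- The infimum of the arcs from other points of `Z` to `x` is positive by discreteness. The point
`s` at this distance before `x` lies in the closure of `Z`. If it were not in `Z`, admissibility
would give points of `Z` just above `s`, hence closer to `x` than the infimum. -/
theorem exists_pred (hZ : IsAdmissible Z) (x : Z) : ∃ w : Z, IsSucc Z w x := by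
  have hx : (x : S1) ∈ Z := x.2
  obtain ⟨ε, hε, hball⟩ := Metric.eventually_nhds_iff.1 (hZ.eventually_eq hx)
  set A : Set ℝ := (fun w : S1 => arc w x) '' (Z \ {(x : S1)}) with hA
  have hA₀ : ∀ a ∈ A, ε ≤ a := by
    rintro _ ⟨w, ⟨hw, hwx⟩, rfl⟩
    by_contra h
    exact hwx (hball ((dist_le_arc w x).trans_lt (not_le.1 h)) hw)
  have hne : A.Nonempty := by
    obtain ⟨w, hw⟩ := (hZ.infinite.sdiff (Set.finite_singleton (x : S1))).nonempty
    exact ⟨_, w, hw, rfl⟩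
  have hbdd : BddBelow A := ⟨ε, hA₀⟩
  have hρ : ε ≤ sInf A := le_csInf hne hA₀
  have hρ₁ : sInf A < 1 := by
    obtain ⟨_, w, hw, rfl⟩ := hne
    exact (csInf_le hbdd ⟨w, hw, rfl⟩).trans_lt (arc_lt_one w x)
  set s : S1 := (x : S1) - (sInf A : ℝ) with hs
  have hsx : arc s x = sInf A := arc_eq_of_coe_eq (hε.le.trans hρ) hρ₁ (by simp [hs])
  have hsx' : s ≠ x := by rw [← arc_pos_iff, hsx]; linarith
  have hclos : s ∈ closure Z := by
    rw [Metric.mem_closure_iff]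
    intro δ hδ
    obtain ⟨_, ⟨w, hw, rfl⟩, hwδ⟩ := exists_lt_of_csInf_lt hne (show sInf A < sInf A + δ by linarith)
    refine ⟨w, hw.1, ?_⟩
    have h₁ : sInf A ≤ arc w x := csInf_le hbdd ⟨w, hw, rfl⟩
    have h₂ : arc w s = arc w x - sInf A :=
      arc_eq_of_coe_eq (by linarith) (by linarith [arc_lt_one w x])
        (by rw [AddCircle.coe_sub, coe_arc, hs]; abel)
    rw [dist_comm]
    refine (dist_le_arc w s).trans_lt ?_
    change arc w x < _ at hwδ
    linarith
  have hsZ : s ∈ Z := by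
    by_contra hsZ
    obtain ⟨y, hy⟩ := hZ.exists_arc_lt hclos (show 0 < sInf A by linarith)
    have hpos : 0 < arc s y := arc_pos_iff.2 fun h => hsZ (h ▸ y.2)
    have hyx : arc (y : S1) x = sInf A - arc s y := by
      rw [arc_eq_sub s, hsx, if_neg (by linarith)]; ring
    have : sInf A ≤ arc (y : S1) x := by
      refine csInf_le hbdd ⟨y, ⟨y.2, fun h => ?_⟩, rfl⟩
      rw [show (y : S1) = x from h, hsx] at hy
      exact lt_irrefl _ hy
    linarith
  refine ⟨⟨s, hsZ⟩, fun h => hsx' (congrArg Subtype.val h), fun u hu => ?_⟩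
  rw [sbtw_iff_arc] at hu
  change 0 < arc s u ∧ arc s u < arc s x at hu
  have hux : arc (u : S1) x = sInf A - arc s u := by
    rw [arc_eq_sub s, hsx, if_neg (by linarith)]; ring
  have : sInf A ≤ arc (u : S1) x := by
    refine csInf_le hbdd ⟨u, ⟨u.2, fun h => ?_⟩, rfl⟩
    rw [h] at hu
    exact lt_irrefl _ hu.2
  linarith

end IsAdmissible

/-! ### Limits of diagonals -/

/-- The pairs `(x₀, x₁)` with `{x₀, x₁} ∈ X`. -/
def pairs (X : Set (Sym2 Z)) : Set (S1 × S1) :=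
  {a | ∃ x₀ x₁ : Z, s(x₀, x₁) ∈ X ∧ a = ((x₀ : S1), (x₁ : S1))}

/-- Each limit of diagonals in `X` with distinct ends is also a limit of diagonals in `X` whose
ends converge from above. -/
def LimitsFromAbove (X : Set (Sym2 Z)) : Prop :=
  ∀ p q : S1, p ≠ q → (p, q) ∈ closure (pairs X) → ∃ x₀ x₁ : ℕ → Z, (∀ i, s(x₀ i, x₁ i) ∈ X) ∧
    TendstoAbove (fun i => (x₀ i : S1)) p ∧ TendstoAbove (fun i => (x₁ i : S1)) q

/-- A neighbourhood of `(p, q)` is covered by four quadrants, and a limit of diagonals is a limit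
within one of them. Below-below is PC1, the two mixed quadrants are PC2 up to swapping the ends, and
above-above needs nothing. -/
theorem limitsFromAbove_iff {X : Set (Sym2 Z)} : LimitsFromAbove X ↔ PC1 Z X ∧ PC2 Z X := by
  have key {p q : S1} {x₀ x₁ : ℕ → Z} (hx : ∀ i, s(x₀ i, x₁ i) ∈ X)
      (h₀ : Tendsto (fun i => (x₀ i : S1)) atTop (𝓝 p))
      (h₁ : Tendsto (fun i => (x₁ i : S1)) atTop (𝓝 q)) : (p, q) ∈ closure (pairs X) :=
    mem_closure_of_tendsto (h₀.prodMk_nhds h₁)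
      (Eventually.of_forall fun i => ⟨x₀ i, x₁ i, hx i, rfl⟩)
  refine ⟨fun h => ⟨?_, ?_⟩, ?_⟩
  · rintro p q hpq ⟨x₀, x₁, hx, h₀, h₁⟩
    exact h p q hpq (key hx h₀.1 h₁.1)
  · rintro p q hpq ⟨x₀, x₁, hx, h₀, h₁⟩
    exact h p q hpq (key hx h₀.1 h₁.1)
  · rintro ⟨h₁, h₂⟩ p q hpq h
    let B (p : S1) : Set S1 := {x | arc x p ≤ 2⁻¹}
    let A (p : S1) : Set S1 := {x | arc p x ≤ 2⁻¹}
    have hAB (p x : S1) : x ∈ B p ∨ x ∈ A p := by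
      by_contra hc
      simp only [B, A, Set.mem_ofPred_eq, not_or, not_le] at hc
      have : x ≠ p := fun h => by
        rw [h, arc_self] at hc
        norm_num at hc
      rw [arc_comm this] at hc
      norm_num at hc
      linarith
    have hcover : pairs X ⊆ (pairs X ∩ B p ×ˢ B q ∪ pairs X ∩ B p ×ˢ A q) ∪
        (pairs X ∩ A p ×ˢ B q ∪ pairs X ∩ A p ×ˢ A q) := by
      intro a ha
      rcases hAB p a.1 with h | h <;> rcases hAB q a.2 with h' | h' <;>
        simp [ha, h, h']
    have hseq (U V : Set S1) (h : (p, q) ∈ closure (pairs X ∩ U ×ˢ V)) :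
        ∃ x₀ x₁ : ℕ → Z, (∀ i, s(x₀ i, x₁ i) ∈ X) ∧ (∀ i, (x₀ i : S1) ∈ U) ∧
          (∀ i, (x₁ i : S1) ∈ V) ∧ Tendsto (fun i => (x₀ i : S1)) atTop (𝓝 p) ∧
          Tendsto (fun i => (x₁ i : S1)) atTop (𝓝 q) := by
      obtain ⟨a, ha, hlim⟩ := mem_closure_iff_seq_limit.1 h
      choose x₀ x₁ hx hax using fun i => (ha i).1
      have h₀ (i) : (x₀ i : S1) = (a i).1 := by rw [hax i]
      have h₁ (i) : (x₁ i : S1) = (a i).2 := by rw [hax i]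
      refine ⟨x₀, x₁, hx, fun i => h₀ i ▸ (ha i).2.1, fun i => h₁ i ▸ (ha i).2.2, ?_, ?_⟩
      · simp only [h₀]
        exact (continuous_fst.tendsto _).comp hlim
      · simp only [h₁]
        exact (continuous_snd.tendsto _).comp hlim
    have := closure_mono hcover h
    rw [closure_union, closure_union, closure_union] at this
    rcases this with (h | h) | (h | h) <;> obtain ⟨x₀, x₁, hx, hU, hV, hl₀, hl₁⟩ := hseq _ _ h
    · exact h₁ p q hpq ⟨x₀, x₁, hx, tendstoBelow_of_arc_le hl₀ hU, tendstoBelow_of_arc_le hl₁ hV⟩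
    · exact h₂ p q hpq ⟨x₀, x₁, hx, tendstoBelow_of_arc_le hl₀ hU, tendstoAbove_of_arc_le hl₁ hV⟩
    -- Above-below becomes below-above when the ends are exchanged, as diagonals are unordered.
    · obtain ⟨y₁, y₀, hy, h', h''⟩ := h₂ q p hpq.symm ⟨x₁, x₀, fun i => Sym2.eq_swap ▸ hx i,
        tendstoBelow_of_arc_le hl₁ hV, tendstoAbove_of_arc_le hl₀ hU⟩
      exact ⟨y₀, y₁, fun i => Sym2.eq_swap ▸ hy i, h'', h'⟩
    · exact ⟨x₀, x₁, hx, tendstoAbove_of_arc_le hl₀ hU, tendstoAbove_of_arc_le hl₁ hV⟩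

/-! ### Finite dominating sets of diagonals -/

/-- `p` is the first point of `S` that is met when moving anticlockwise from `x`. -/
def IsFirst (S : Set S1) (x p : S1) : Prop := p ∈ S ∧ ∀ p' ∈ S, arc x p ≤ arc x p'

theorem IsFirst.unique {S : Set S1} {x p q : S1} (hp : IsFirst S x p) (hq : IsFirst S x q) :
    p = q :=
  arc_injective x (le_antisymm (hp.2 q hq.1) (hq.2 p hp.1))

theorem exists_isFirst {S : Set S1} (hS : S.Finite) (hne : S.Nonempty) (x : S1) :
    ∃ p, IsFirst S x p :=
  Set.exists_min_image S (arc x) hS hne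

/-- Away from `S`, the arcs to the finitely many points of `S` are continuous, so their strict order
persists nearby. -/
theorem IsFirst.eventually {S : Set S1} (hS : S.Finite) {u p : S1} (hu : u ∉ S)
    (hp : IsFirst S u p) : ∀ᶠ x in 𝓝 u, IsFirst S x p := by
  have : ∀ᶠ x in 𝓝 u, ∀ p' ∈ S, arc x p ≤ arc x p' := by
    rw [eventually_all_finite hS]
    intro p' hp'
    by_cases h : p = p'
    · exact Eventually.of_forall fun x => by rw [h]
    · have hlt : arc u p < arc u p' :=
        lt_of_le_of_ne (hp.2 p' hp') fun h' => h (arc_injective u h')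
      have h₁ := continuousAt_arc_left (p := u) (q := p) fun h => hu (h ▸ hp.1)
      have h₂ := continuousAt_arc_left (p := u) (q := p') fun h => hu (h ▸ hp')
      exact (h₁.eventually_lt h₂ hlt).mono fun x => le_of_lt
  exact this.mono fun x hx => ⟨hp.1, hx⟩

theorem IsAdmissible.eventually_isFirst_of_mem (hZ : IsAdmissible Z) {S : Set S1} {u p : S1}
    (hu : u ∈ Z) (hp : IsFirst S u p) : ∀ᶠ x in 𝓝 u, x ∈ Z → IsFirst S x p :=
  (hZ.eventually_eq hu).mono fun _ h hx => (h hx).symm ▸ hp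

theorem IsAdmissible.eventually_isFirst (hZ : IsAdmissible Z) {S : Set S1} (hS : S.Finite)
    (hSZ : S ⊆ Z) {u p : S1} (hp : IsFirst S u p) : ∀ᶠ x in 𝓝 u, x ∈ Z → IsFirst S x p := by
  by_cases hu : u ∈ Z
  · exact hZ.eventually_isFirst_of_mem hu hp
  · exact (hp.eventually hS fun h => hu (hSZ h)).mono fun _ h _ => h

/-- Points of `Z` that converge to `u` from above eventually lie beyond all points of `Z` in a
neighbourhood of `u`. -/
theorem IsAdmissible.eventually_dominates (hZ : IsAdmissible Z) {S : Set S1} (hSZ : S ⊆ Z)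
    {u p : S1} (hp : IsFirst S u p) {z : ℕ → Z} (hz : TendstoAbove (fun i => (z i : S1)) u) :
    ∀ᶠ i in atTop, ∀ᶠ x in 𝓝 u, x ∈ Z → arc (z i) p ≤ arc x p := by
  by_cases hu : u ∈ Z
  · filter_upwards [hz.1.eventually (hZ.eventually_eq hu)] with i hi
    filter_upwards [hZ.eventually_eq hu] with x hx hxZ
    rw [hx hxZ, hi (z i).2]
  · have hup : u ≠ p := fun h => hu (hSZ (h ▸ hp.1))
    filter_upwards [(tendstoAbove_iff.1 hz).eventually_lt_const (arc_pos_iff.2 hup)] with i hi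
    have hzi : 0 < arc u (z i) := arc_pos_iff.2 fun h => hu (h ▸ (z i).2)
    have : arc (z i) p < arc u p := by
      rw [arc_eq_sub u, if_neg (by linarith)]
      linarith
    filter_upwards [(continuousAt_arc_left hup).eventually_const_lt this] with x hx _ using hx.le

/-- By compactness of the torus it suffices to treat a neighbourhood of each `(u, v)`. If diagonals
of the given type accumulate there, then `u` and `v` first meet `p` and `q`, so `u ≠ v`. A diagonal
of `X` coming from above and close enough to `(u, v)` then lies ahead of all diagonals in some
neighbourhood. -/
theorem IsAdmissible.exists_finite_dominating (hZ : IsAdmissible Z) {X : Set (Sym2 Z)}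
    (hX : LimitsFromAbove X) {S : Set S1} (hS : S.Finite) (hSZ : S ⊆ Z) {p q : S1} (hpq : p ≠ q) :
    ∃ F : Set (Z × Z), F.Finite ∧
      (∀ f ∈ F, s(f.1, f.2) ∈ X ∧ IsFirst S f.1 p ∧ IsFirst S f.2 q) ∧
      ∀ x₀ x₁ : Z, s(x₀, x₁) ∈ X → IsFirst S x₀ p → IsFirst S x₁ q →
        ∃ f ∈ F, arc f.1 p ≤ arc x₀ p ∧ arc f.2 q ≤ arc x₁ q := by
  let P (V : Set (S1 × S1)) : Prop := ∃ F : Set (Z × Z), F.Finite ∧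
    (∀ f ∈ F, s(f.1, f.2) ∈ X ∧ IsFirst S f.1 p ∧ IsFirst S f.2 q) ∧
    ∀ x₀ x₁ : Z, s(x₀, x₁) ∈ X → IsFirst S x₀ p → IsFirst S x₁ q → ((x₀ : S1), (x₁ : S1)) ∈ V →
      ∃ f ∈ F, arc f.1 p ≤ arc x₀ p ∧ arc f.2 q ≤ arc x₁ q
  suffices h : P Set.univ by
    obtain ⟨F, h₁, h₂, h₃⟩ := h
    exact ⟨F, h₁, h₂, fun x₀ x₁ h h' h'' => h₃ x₀ x₁ h h' h'' trivial⟩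
  refine isCompact_univ.induction_on (p := P) ?_ ?_ ?_ ?_
  · exact ⟨∅, Set.finite_empty, by simp, by simp⟩
  · rintro V W hVW ⟨F, h₁, h₂, h₃⟩
    exact ⟨F, h₁, h₂, fun x₀ x₁ h h' h'' h''' => h₃ x₀ x₁ h h' h'' (hVW h''')⟩
  · rintro V W ⟨F, h₁, h₂, h₃⟩ ⟨G, h₁', h₂', h₃'⟩
    refine ⟨F ∪ G, h₁.union h₁', ?_, ?_⟩
    · rintro f (hf | hf)
      exacts [h₂ f hf, h₂' f hf]
    · rintro x₀ x₁ h h' h'' (hV | hW)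
      · obtain ⟨f, hf, hf'⟩ := h₃ x₀ x₁ h h' h'' hV
        exact ⟨f, Or.inl hf, hf'⟩
      · obtain ⟨f, hf, hf'⟩ := h₃' x₀ x₁ h h' h'' hW
        exact ⟨f, Or.inr hf, hf'⟩
  · rintro ⟨u, v⟩ -
    rw [nhdsWithin_univ]
    by_cases hfreq : ∃ᶠ a in 𝓝 (u, v), ∃ x₀ x₁ : Z, s(x₀, x₁) ∈ X ∧ IsFirst S x₀ p ∧
        IsFirst S x₁ q ∧ a = ((x₀ : S1), (x₁ : S1))
    · have hne : S.Nonempty := by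
        obtain ⟨_, x₀, _, _, h, _⟩ := hfreq.exists
        exact ⟨p, h.1⟩
      obtain ⟨p', hp'⟩ := exists_isFirst hS hne u
      obtain ⟨q', hq'⟩ := exists_isFirst hS hne v
      have hep := hZ.eventually_isFirst hS hSZ hp'
      have heq := hZ.eventually_isFirst hS hSZ hq'
      obtain ⟨a, ⟨x₀, x₁, hx, h₀, h₁, rfl⟩, h₀', h₁'⟩ :=
        (hfreq.and_eventually (hep.prod_nhds heq)).exists
      obtain rfl := (h₀' x₀.2).unique h₀
      obtain rfl := (h₁' x₁.2).unique h₁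
      have huv : u ≠ v := by
        rintro rfl
        exact hpq (hp'.unique hq')
      obtain ⟨z₀, z₁, hz, hz₀, hz₁⟩ := hX u v huv (mem_closure_iff_frequently.2
        (hfreq.mono fun a ⟨x₀, x₁, hx, _, _, ha⟩ => ⟨x₀, x₁, hx, ha⟩))
      obtain ⟨i, hi₀, hi₁, hi₀', hi₁'⟩ := ((hZ.eventually_dominates hSZ hp' hz₀).and
        ((hZ.eventually_dominates hSZ hq' hz₁).and ((hz₀.1.eventually hep).and
          (hz₁.1.eventually heq)))).exists
      refine ⟨_, hi₀.prod_nhds hi₁, {(z₀ i, z₁ i)}, Set.finite_singleton _, ?_, ?_⟩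
      · rintro _ rfl
        exact ⟨hz i, hi₀' (z₀ i).2, hi₁' (z₁ i).2⟩
      · rintro x₀ x₁ - - - ⟨h, h'⟩
        exact ⟨_, rfl, h x₀.2, h' x₁.2⟩
    -- No diagonal of this type is near `(u, v)`, so the empty set dominates.
    · rw [not_frequently] at hfreq
      exact ⟨_, hfreq, ∅, Set.finite_empty, by simp,
        fun x₀ x₁ h h' h'' hV => absurd ⟨x₀, x₁, h, h', h'', rfl⟩ hV⟩

/-! ### Points close to a limit of diagonals -/

/-- The position of `{x₀, x₁}` relative to `{y₀, y₁}` in which there are morphisms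
`M(x₀, x₁) ⟶ M(y₀, y₁)` that do not factor through a projective-injective object. -/
structure IsBefore (x₀ x₁ y₀ y₁ : Z) : Prop where
  lt : arc x₀ y₀ < arc x₀ x₁
  le : arc (x₀ : S1) x₁ ≤ arc x₀ y₁
  not_succ : ¬ IsSucc Z y₀ x₁
  not_succ' : ¬ IsSucc Z y₁ x₀

/-- `y` is at or slightly above `p`, with points of `Z` slightly below `p` and above `y`
unless `p ∈ Z`. -/
structure IsCloseAbove (p : S1) (y : Z) (ε : ℝ) : Prop where
  arc_lt : arc p y < ε
  eventually_arc_lt : ∀ᶠ x in 𝓝 p, x ∈ Z → arc x y < ε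
  gap : p ∈ Z ∧ y = p ∨ (∃ w : Z, w ≠ y ∧ arc y w < ε) ∧
    ∃ w : Z, ∀ᶠ x in 𝓝 p, 0 < arc w x ∧ arc w x < ε

theorem IsAdmissible.exists_isCloseAbove (hZ : IsAdmissible Z) {p : S1} (hp : p ∈ closure Z) {ε : ℝ}
    (hε : 0 < ε) : ∃ y : Z, IsCloseAbove p y ε := by
  by_cases hpZ : p ∈ Z
  · refine ⟨⟨p, hpZ⟩, by simpa [arc_self] using hε, ?_, Or.inl ⟨hpZ, rfl⟩⟩
    filter_upwards [hZ.eventually_eq hpZ] with x hx hxZ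
    rwa [hx hxZ, arc_self]
  · have hne (y : Z) : p ≠ y := fun h => hpZ (h ▸ y.2)
    obtain ⟨w, hw⟩ := hZ.exists_arc_lt hp hε
    obtain ⟨y, hy⟩ := hZ.exists_arc_lt hp (arc_pos_iff.2 (hne w))
    obtain ⟨w', hw'⟩ := hZ.exists_arc_lt' hp hε
    refine ⟨y, hy.trans hw, ?_, Or.inr ⟨⟨w, ?_, ?_⟩, w', ?_⟩⟩
    · exact ((continuousAt_arc_left (hne y)).eventually_lt_const (hy.trans hw)).mono fun _ h _ => h
    · rintro rfl
      exact lt_irrefl _ hy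
    · rw [arc_eq_sub p, if_neg hy.not_gt]
      linarith [arc_nonneg p y]
    · have := continuousAt_arc_right (hne w').symm
      exact (this.eventually_const_lt (arc_pos_iff.2 (hne w').symm)).and
        (this.eventually_lt_const hw')

/-- A point of `Z` strictly between `y₀` and `x₁` is supplied just above `y₀` or just below `q` by
`gap`. If neither is available, then `p` and `q` lie in the discrete set `Z` and `y₀ = p`, so `x₀ =
y₀`, and `x₁` is not its successor because `{x₀, x₁}` is a diagonal. -/
theorem IsCloseAbove.eventually_not_isSucc (hZ : IsAdmissible Z) {X : Set (Sym2 Z)}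
    (hX : ∀ e ∈ X, IsDiagonal Z e) {p q : S1} {y₀ y₁ : Z} {ε : ℝ} (h₀ : IsCloseAbove p y₀ ε)
    (h₁ : IsCloseAbove q y₁ ε) (hpq : p ≠ q) (hε : 2 * ε < arc p q) :
    ∀ᶠ x in 𝓝 (p, q), ∀ x₀ x₁ : Z, s(x₀, x₁) ∈ X → x = ((x₀ : S1), (x₁ : S1)) →
      ¬ IsSucc Z y₀ x₁ := by
  have harc := (continuousAt_arc hpq).eventually_const_lt hε
  have hclose := h₀.eventually_arc_lt.prod_inl_nhds q
  have main : ∀ᶠ x in 𝓝 (p, q), ∀ x₀ x₁ : Z, x = ((x₀ : S1), (x₁ : S1)) → ε < arc y₀ x₁ := by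
    filter_upwards [harc, hclose] with x h h' x₀ x₁ hx
    subst hx
    have := h' x₀.2
    change arc (x₀ : S1) y₀ < ε at this
    change 2 * ε < arc (x₀ : S1) x₁ at h
    rw [arc_eq_sub x₀, if_neg (by linarith [arc_nonneg (x₀ : S1) y₀])]
    linarith
  rcases h₀.gap with ⟨hp, hp'⟩ | ⟨⟨w, hwy, hw⟩, -⟩
  · rcases h₁.gap with ⟨hq, hq'⟩ | ⟨-, w, hw⟩
    · filter_upwards [(hZ.eventually_eq hp).prod_nhds (hZ.eventually_eq hq)] with x h x₀ x₁ hx hx'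
      subst hx'
      have e₀ : x₀ = y₀ := Subtype.ext ((h.1 x₀.2).trans hp'.symm)
      exact e₀ ▸ (hX _ hx x₀ x₁ rfl).2.1
    · filter_upwards [main, hw.prod_inr_nhds p] with x h h' x₀ x₁ _ hx hs
      have hlt := h x₀ x₁ hx
      subst hx
      refine hs.2 w (sbtw_iff_arc.2 ?_)
      have := h'.2
      have h'' := h'.1
      change arc (w : S1) x₁ < ε at this
      change 0 < arc (w : S1) x₁ at h''
      rw [arc_eq_sub y₀] at this h''
      have h3 := arc_lt_one y₀ w
      have h4 := arc_nonneg y₀ w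
      split_ifs at this h'' with hc
      · linarith
      · exact ⟨by linarith, by linarith⟩
  · filter_upwards [main] with x h x₀ x₁ _ hx hs
    exact hs.2 w (sbtw_iff_arc.2 ⟨arc_pos_iff.2 fun h => hwy (Subtype.ext h.symm),
      hw.trans (h x₀ x₁ hx)⟩)

/-- The arcs from `x₀` to `y₀` and from `x₁` to `y₁` are shorter than `ε`, while the two arcs
between `x₀` and `x₁` are longer than `2 * ε`; this fixes the cyclic order. -/
theorem IsCloseAbove.eventually_isBefore (hZ : IsAdmissible Z) {X : Set (Sym2 Z)}
    (hX : ∀ e ∈ X, IsDiagonal Z e) {p q : S1} {y₀ y₁ : Z} {ε : ℝ} (h₀ : IsCloseAbove p y₀ ε)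
    (h₁ : IsCloseAbove q y₁ ε) (hpq : p ≠ q) (hε : 2 * ε < arc p q) (hε' : 2 * ε < arc q p) :
    ∀ᶠ x in 𝓝 (p, q), ∀ x₀ x₁ : Z, s(x₀, x₁) ∈ X → x = ((x₀ : S1), (x₁ : S1)) →
      IsBefore x₀ x₁ y₀ y₁ := by
  have hs := (continuous_swap.tendsto (p, q)).eventually
    (h₁.eventually_not_isSucc hZ hX h₀ hpq.symm hε')
  have harc := (continuousAt_arc hpq).eventually_const_lt hε
  have harc' := (continuous_swap.tendsto (p, q)).eventually
    ((continuousAt_arc hpq.symm).eventually_const_lt hε')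
  filter_upwards [h₀.eventually_not_isSucc hZ hX h₁ hpq hε, hs, harc, harc',
    h₀.eventually_arc_lt.prod_nhds h₁.eventually_arc_lt] with x k₁ k₂ k₃ k₄ k₅ x₀ x₁ hx hx'
  subst hx'
  obtain ⟨k₅, k₆⟩ := k₅
  have k₅ := k₅ x₀.2
  have k₆ := k₆ x₁.2
  dsimp only [Prod.swap] at k₃ k₄ k₅ k₆
  have h2 := arc_nonneg (x₀ : S1) y₀
  refine ⟨by linarith, ?_, k₁ x₀ x₁ hx rfl, k₂ x₁ x₀ (Sym2.eq_swap ▸ hx) rfl⟩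
  have hne : (x₀ : S1) ≠ x₁ := by
    rw [← arc_pos_iff]; linarith
  have h1 := arc_nonneg (x₀ : S1) y₁
  rw [arc_comm hne] at k₄
  rw [arc_eq_sub x₀] at k₆
  split_ifs at k₆ with hc
  · linarith
  · exact not_lt.1 hc

/-- Domination passes to the limit. -/
theorem IsAdmissible.arc_le_of_frequently (hZ : IsAdmissible Z) {p : S1} {y f : Z}
    {ι : Type*} {l : Filter ι} {x : ι → Z} (hx : Tendsto (fun i => (x i : S1)) l (𝓝 p))
    (h : ∃ᶠ i in l, arc (x i) f ≤ arc (x i) y) : arc p f ≤ arc p y := by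
  by_cases hp : p ∈ Z
  · obtain ⟨i, hi, hi'⟩ := (h.and_eventually (hx.eventually (hZ.eventually_eq hp))).exists
    rwa [hi' (x i).2] at hi
  · have hne (y : Z) : p ≠ y := fun h => hp (h ▸ y.2)
    by_contra hlt
    have := hx.eventually ((continuousAt_arc_left (hne y)).eventually_lt
      (continuousAt_arc_left (hne f)) (not_le.1 hlt))
    exact h (this.mono fun i hi => not_le.2 hi)

end

section

variable {k : Type*} [Field k] {Z : Set S1}

/-! ### Entries of morphisms -/

/-- The entries of a morphism, as power series. -/
def entry {P Q : Mat_ (Pt k Z)} (f : P ⟶ Q) (i : P.ι) (j : Q.ι) : PowerSeries k := f i j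

theorem entry_ext {P Q : Mat_ (Pt k Z)} {f g : P ⟶ Q} (h : ∀ i j, entry f i j = entry g i j) :
    f = g :=
  Mat_.hom_ext f g h

theorem entry_comp {P Q R : Mat_ (Pt k Z)} (f : P ⟶ Q) (g : Q ⟶ R) (i : P.ι) (j : R.ι) :
    entry (f ≫ g) i j = ∑ l, PowerSeries.X ^ cocycle (P.X i).pt (Q.X l).pt (R.X j).pt *
      (entry f i l * entry g l j) := by
  unfold entry
  rw [Mat_.comp_apply]
  rfl

theorem entry_add {P Q : Mat_ (Pt k Z)} (f g : P ⟶ Q) (i : P.ι) (j : Q.ι) :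
    entry (f + g) i j = entry f i j + entry g i j := rfl

theorem cocycle_self_left (x y : S1) : cocycle x x y = 0 := by simp [cocycle]

theorem cocycle_self_right (x y : S1) : cocycle x y y = 0 := by simp [cocycle]

namespace Frob

/-- The end of the pair `x`, `y` with index `b`. -/
abbrev ends (x y : Z) (b : Bool) : Z := bif b then y else x

theorem entry_pairD (x y : Z) (i j : Bool) :
    entry (pairD k x y) i j = if j = !i then 1 else 0 := by
  cases i <;> cases j <;> rfl

variable {x₀ x₁ y₀ y₁ z₀ z₁ : Z}

theorem entry_pairD_comp {T : Mat_ (Pt k Z)} (f : pairP k x₀ x₁ ⟶ T) (i : Bool) (j : T.ι) :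
    entry (pairD k x₀ x₁ ≫ f) i j =
      PowerSeries.X ^ cocycle (ends x₀ x₁ i) (ends x₀ x₁ !i) (T.X j).pt * entry f (!i) j := by
  rw [entry_comp]
  refine (Fintype.sum_bool _).trans ?_
  cases i <;> simp [entry_pairD]

/-- The condition that a matrix is a morphism from `M(x₀, x₁)`. -/
def IsHomMatrix (x₀ x₁ : Z) (T : Frob k Z) (φ : Bool → T.P.ι → PowerSeries k) : Prop :=
  ∀ i j, PowerSeries.X ^ cocycle (ends x₀ x₁ i) (ends x₀ x₁ !i) (T.P.X j).pt * φ (!i) j =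
    ∑ l, PowerSeries.X ^ cocycle (ends x₀ x₁ i) (T.P.X l).pt (T.P.X j).pt * (φ i l * entry T.d l j)

/-- The matrix of a morphism from `M(x₀, x₁)`. -/
def mat {h : x₀ ≠ x₁} {T : Frob k Z} (g : M k x₀ x₁ h ⟶ T) (i : Bool) (j : T.P.ι) :
    PowerSeries k := g.f i j

/-- The matrix of a morphism `M(x₀, x₁) ⟶ M(y₀, y₁)`. -/
def matM {h : x₀ ≠ x₁} {h' : y₀ ≠ y₁} (g : M k x₀ x₁ h ⟶ M k y₀ y₁ h') (i j : Bool) :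
    PowerSeries k := g.f i j

theorem mat_ext {h : x₀ ≠ x₁} {T : Frob k Z} {g g' : M k x₀ x₁ h ⟶ T}
    (H : ∀ i j, mat g i j = mat g' i j) : g = g' :=
  hom_ext (entry_ext H)

theorem mat_comp {h : x₀ ≠ x₁} {h' : y₀ ≠ y₁} {T : Frob k Z} (u : M k x₀ x₁ h ⟶ M k y₀ y₁ h')
    (v : M k y₀ y₁ h' ⟶ T) (i : Bool) (j : T.P.ι) : mat (u ≫ v) i j =
      PowerSeries.X ^ cocycle (ends x₀ x₁ i) y₁ (T.P.X j).pt * (matM u i true * mat v true j) +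
      PowerSeries.X ^ cocycle (ends x₀ x₁ i) y₀ (T.P.X j).pt * (matM u i false * mat v false j) :=
  (entry_comp (P := pairP k x₀ x₁) (Q := pairP k y₀ y₁) u.f v.f i j).trans (Fintype.sum_bool _)

theorem isHomMatrix_mat {h : x₀ ≠ x₁} {T : Frob k Z} (g : M k x₀ x₁ h ⟶ T) :
    IsHomMatrix x₀ x₁ T (mat g) := fun i j => by
  have : entry (P := pairP k x₀ x₁) (pairD k x₀ x₁ ≫ g.f) i j =
      entry (P := pairP k x₀ x₁) (g.f ≫ T.d) i j :=
    congrArg (fun f : pairP k x₀ x₁ ⟶ T.P => entry f i j) g.comm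
  exact (entry_pairD_comp (T := T.P) g.f i j).symm.trans
    (this.trans (entry_comp (P := pairP k x₀ x₁) g.f T.d i j))

/-- The morphism from `M(x₀, x₁)` with given matrix. -/
def ofMatrix (h : x₀ ≠ x₁) {T : Frob k Z} (φ : Bool → T.P.ι → PowerSeries k)
    (hφ : IsHomMatrix x₀ x₁ T φ) : M k x₀ x₁ h ⟶ T where
  f := fun i j => φ i j
  comm := by
    refine entry_ext (P := pairP k x₀ x₁) fun i j => ?_
    refine (entry_pairD_comp (T := T.P) (fun i j => φ i j) i j).trans ((hφ i j).trans ?_)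
    exact (entry_comp (P := pairP k x₀ x₁) (fun i j => φ i j) T.d i j).symm

theorem isHomMatrix_M_iff {h : y₀ ≠ y₁} {φ : Bool → Bool → PowerSeries k} :
    IsHomMatrix x₀ x₁ (M k y₀ y₁ h) φ ↔ ∀ i j,
      PowerSeries.X ^ cocycle (ends x₀ x₁ i) (ends x₀ x₁ !i) (ends y₀ y₁ j) * φ (!i) j =
        PowerSeries.X ^ cocycle (ends x₀ x₁ i) (ends y₀ y₁ !j) (ends y₀ y₁ j) * φ i !j := by
  refine forall_congr' fun i => forall_congr' fun j => ?_
  refine Eq.congr_right ?_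
  refine (Fintype.sum_bool _).trans ?_
  change PowerSeries.X ^ cocycle (ends x₀ x₁ i) y₁ (ends y₀ y₁ j) *
      (φ i true * entry (pairD k y₀ y₁) true j) +
    PowerSeries.X ^ cocycle (ends x₀ x₁ i) y₀ (ends y₀ y₁ j) *
      (φ i false * entry (pairD k y₀ y₁) false j) = _
  cases j <;> simp [entry_pairD]

theorem matM_comm {h : x₀ ≠ x₁} {h' : y₀ ≠ y₁} (g : M k x₀ x₁ h ⟶ M k y₀ y₁ h') (i j : Bool) :
    PowerSeries.X ^ cocycle (ends x₀ x₁ i) (ends x₀ x₁ !i) (ends y₀ y₁ j) * matM g (!i) j =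
      PowerSeries.X ^ cocycle (ends x₀ x₁ i) (ends y₀ y₁ !j) (ends y₀ y₁ j) * matM g i !j :=
  isHomMatrix_M_iff.1 (isHomMatrix_mat g) i j

/-- The relative position of two pairs of points in which the diagonal matrix with entries `1` is a
morphism. -/
def IsParallel (x₀ x₁ y₀ y₁ : Z) : Prop :=
  ∀ i, cocycle (ends x₀ x₁ i) (ends x₀ x₁ !i) (ends y₀ y₁ !i) = 0 ∧
    cocycle (ends x₀ x₁ i) (ends y₀ y₁ i) (ends y₀ y₁ !i) = 0

theorem IsParallel.refl (x₀ x₁ : Z) : IsParallel x₀ x₁ x₀ x₁ := fun _ =>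
  ⟨cocycle_self_right _ _, cocycle_self_left _ _⟩

/-- The morphism `M(x₀, x₁) ⟶ M(y₀, y₁)` with both diagonal entries equal to `r`. -/
def diagHom (h : x₀ ≠ x₁) (h' : y₀ ≠ y₁) (hp : IsParallel x₀ x₁ y₀ y₁) (r : PowerSeries k) :
    M k x₀ x₁ h ⟶ M k y₀ y₁ h' :=
  ofMatrix h (fun i (j : Bool) => if i = j then r else 0) <| isHomMatrix_M_iff.2 fun i j => by
    rcases Bool.eq_or_eq_not j i with rfl | rfl
    · simp
    · rw [Bool.not_not, (hp i).1, (hp i).2, if_pos rfl, if_pos rfl]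

theorem mat_diagHom_comp (h : x₀ ≠ x₁) (h' : y₀ ≠ y₁) (hp : IsParallel x₀ x₁ y₀ y₁)
    (r : PowerSeries k) {T : Frob k Z} (g : M k y₀ y₁ h' ⟶ T) (i : Bool) (j : T.P.ι) :
    mat (diagHom h h' hp r ≫ g) i j =
      PowerSeries.X ^ cocycle (ends x₀ x₁ i) (ends y₀ y₁ i) (T.P.X j).pt * (r * mat g i j) := by
  have (a b : Bool) : matM (diagHom h h' hp r) a b = if a = b then r else 0 := rfl
  rw [mat_comp, this, this]
  cases i <;> simp

/-- Morphisms from `M(x₀, x₁)` to `T` factor through `M(y₀, y₁)` if no point of `T` comes between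
`x₀` and `y₀` or between `x₁` and `y₁`. -/
theorem exists_factor (h : x₀ ≠ x₁) (h' : y₀ ≠ y₁) (hp : IsParallel x₀ x₁ y₀ y₁) {T : Frob k Z}
    (hT : ∀ i j, cocycle (ends x₀ x₁ i) (ends y₀ y₁ i) (T.P.X j).pt = 0)
    (g : M k x₀ x₁ h ⟶ T) : ∃ (a : M k x₀ x₁ h ⟶ M k y₀ y₁ h') (b : M k y₀ y₁ h' ⟶ T),
      g = a ≫ b := by
  refine ⟨diagHom h h' hp 1, ofMatrix h' (mat g) ?_, ?_⟩
  · intro i j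
    refine Eq.trans ?_ ((isHomMatrix_mat g i j).trans ?_)
    -- Only the exponents of `t` have to agree; the cocycle identity reduces this to the vanishing
    -- cocycles in `hp` and `hT`.
    · congr 2
      have h₁ := cocycle_add (ends x₀ x₁ i) (ends y₀ y₁ i) (ends y₀ y₁ !i) (T.P.X j).pt
      have h₂ := cocycle_add (ends x₀ x₁ i) (ends x₀ x₁ !i) (ends y₀ y₁ !i) (T.P.X j).pt
      have h₃ := hT i j
      have h₄ := hT (!i) j
      have h₅ := hp i
      omega
    · refine Finset.sum_congr rfl fun l _ => ?_
      congr 2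
      have h₁ := cocycle_add (ends x₀ x₁ i) (ends y₀ y₁ i) (T.P.X l).pt (T.P.X j).pt
      have h₃ := hT i j
      have h₄ := hT i l
      omega
  · refine mat_ext fun i j => ?_
    rw [mat_diagHom_comp, hT i j, pow_zero, one_mul, one_mul]
    rfl

/-- The isomorphism `M(x₀, x₁) ⟶ M(x₁, x₀)`. -/
def swapHom (h : x₀ ≠ x₁) : M k x₀ x₁ h ⟶ M k x₁ x₀ h.symm :=
  ofMatrix h (fun i (j : Bool) => if i = j then 0 else 1) <| isHomMatrix_M_iff.2 fun i j => by
    cases i <;> cases j <;> simp [cocycle]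

theorem swapHom_comp_swapHom (h : x₀ ≠ x₁) {T : Frob k Z} (g : M k x₀ x₁ h ⟶ T) :
    swapHom h ≫ swapHom h.symm ≫ g = g := by
  have key (x₀ x₁ : Z) (h : x₀ ≠ x₁) (g : M k x₁ x₀ h.symm ⟶ T) (i : Bool) (j : T.P.ι) :
      mat (swapHom h ≫ g) i j = mat g (!i) j := by
    have (a b : Bool) : matM (swapHom (k := k) h) a b = if a = b then 0 else 1 := rfl
    rw [mat_comp, this, this]
    cases i <;> simp [cocycle_self_left]
  refine mat_ext fun i j => ?_
  rw [key, key _ _ h.symm, Bool.not_not]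

/-! ### Leading coefficients -/

/-- The constant coefficient of the entry `x₀ ⟶ y₀` of a morphism `M(x₀, x₁) ⟶ M(y₀, y₁)`. -/
def lead {h : x₀ ≠ x₁} {h' : y₀ ≠ y₁} : (M k x₀ x₁ h ⟶ M k y₀ y₁ h') →+ k where
  toFun g := PowerSeries.constantCoeff (R := k) (matM g false false)
  map_zero' := map_zero (PowerSeries.constantCoeff (R := k))
  map_add' _ _ := map_add (PowerSeries.constantCoeff (R := k)) _ _

theorem eq_zero_of_X_pow_mul_eq {a : ℕ} {u v : PowerSeries k}
    (h : PowerSeries.X ^ a * u = v) (hv : PowerSeries.constantCoeff v ≠ 0) : a = 0 := by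
  by_contra ha
  apply hv
  simp [← h, ha]

/-- Some path `x₀ ⟶ z_b ⟶ y₀` contributes a nonzero constant term, so it picks up no factor `t` and
both of its entries are units. Commutation with `d` equates these entries, up to powers of `t`, with
the entries at the other ends, which forces the corresponding cocycles to vanish and places the
other end of the pair between `x₁` and `y₁`. -/
theorem lead_comp_ne_zero {hx : x₀ ≠ x₁} {hy : y₀ ≠ y₁} {hz : z₀ ≠ z₁}
    (hxy : IsBefore x₀ x₁ y₀ y₁) {v : M k x₀ x₁ hx ⟶ M k z₀ z₁ hz} {w : M k z₀ z₁ hz ⟶ M k y₀ y₁ hy}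
    (h : lead (v ≫ w) ≠ 0) : ∃ b, arc x₀ (ends z₀ z₁ b) ≤ arc x₀ y₀ ∧
      arc x₀ x₁ ≤ arc x₀ (ends z₀ z₁ !b) ∧ arc x₀ (ends z₀ z₁ !b) ≤ arc x₀ y₁ := by
  obtain ⟨b, hb⟩ : ∃ b, PowerSeries.constantCoeff (PowerSeries.X ^
      cocycle x₀ (ends z₀ z₁ b) y₀ * (matM v false b * matM w b false)) ≠ 0 := by
    by_contra! hc
    apply h
    refine (congrArg PowerSeries.constantCoeff (mat_comp v w false false)).trans ?_
    rw [map_add]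
    refine (congrArg₂ (· + ·) (hc true) (hc false)).trans (add_zero 0)
  rw [map_mul, map_mul, mul_ne_zero_iff, mul_ne_zero_iff] at hb
  obtain ⟨hc, hv, hw⟩ := hb
  have hc : cocycle x₀ (ends z₀ z₁ b) y₀ = 0 := by
    by_contra hc'
    simp [hc'] at hc
  have hlt := hxy.lt
  have hle := hxy.le
  have h₁ := arc_nonneg (x₀ : S1) (ends z₀ z₁ !b)
  rw [cocycle_eq_zero_iff] at hc
  have hw' := matM_comm w b true
  have hv' := matM_comm v false !b
  rw [Bool.not_not] at hv'
  have h₂ : cocycle (ends z₀ z₁ b) y₀ y₁ = 0 := by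
    rw [cocycle_eq_zero_iff, arc_eq_sub x₀ _ y₀, arc_eq_sub x₀ _ y₁, if_neg (by linarith),
      if_neg (by linarith)]
    linarith
  simp only [ends, cond_true, cond_false, Bool.not_true, h₂, pow_zero, one_mul] at hw'
  have h₃ := eq_zero_of_X_pow_mul_eq hw' hw
  rw [cocycle_eq_zero_iff, arc_eq_sub x₀ _ y₁, if_neg (by linarith)] at h₃
  change arc (ends z₀ z₁ b) (ends z₀ z₁ !b) ≤ arc x₀ y₁ - arc x₀ (ends z₀ z₁ b) + 0 at h₃
  have h₄ : arc x₀ (ends z₀ z₁ b) ≤ arc x₀ (ends z₀ z₁ !b) ∧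
      arc x₀ (ends z₀ z₁ !b) ≤ arc x₀ y₁ := by
    have := arc_lt_one (x₀ : S1) y₁
    rw [arc_eq_sub x₀] at h₃
    split_ifs at h₃ with h₅
    · linarith
    · exact ⟨not_lt.1 h₅, by linarith⟩
  have h₆ : cocycle x₀ (ends z₀ z₁ b) (ends z₀ z₁ !b) = 0 := cocycle_eq_zero_iff.2 h₄.1
  simp only [ends, cond_true, cond_false, Bool.not_false] at hv' h₆
  rw [h₆, pow_zero, one_mul] at hv'
  exact ⟨b, hc, cocycle_eq_zero_iff.1 (eq_zero_of_X_pow_mul_eq hv' hv), h₄.2⟩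

/-- If a morphism through `M(z₀, z₀⁺)` had nonzero leading coefficient, one of `z₀`, `z₀⁺` would lie
in `[x₀, y₀]` and the other in `[x₁, y₁]`. Consecutive points can do so only as `y₀, x₁` or as `y₁,
x₀`, which `IsBefore` excludes. -/
theorem lead_eq_zero_of_mem_null {hx : x₀ ≠ x₁} {hy : y₀ ≠ y₁} (hxy : IsBefore x₀ x₁ y₀ y₁)
    {u : M k x₀ x₁ hx ⟶ M k y₀ y₁ hy} (hu : u ∈ null _ _) : lead u = 0 := by
  suffices null (M k x₀ x₁ hx) (M k y₀ y₁ hy) ≤ lead.ker from this hu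
  refine (AddSubgroup.closure_le _).2 ?_
  rintro _ ⟨z₀, z₁, hs, v, w, rfl⟩
  by_contra hc
  obtain ⟨b, h₁, h₂, h₃⟩ := lead_comp_ne_zero hxy (by exact hc)
  have hlt := hxy.lt
  have h₄ := arc_lt_one (x₀ : S1) y₁
  have h₅ := arc_nonneg (x₀ : S1) z₀
  have h₆ := arc_nonneg (x₀ : S1) z₁
  cases b <;> simp only [ends, cond_true, cond_false, Bool.not_true, Bool.not_false] at h₁ h₂ h₃
  · have hz : arc (z₀ : S1) z₁ = arc x₀ z₁ - arc x₀ z₀ := by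
      rw [arc_eq_sub x₀, if_neg (by linarith)]; ring
    have hy : arc (z₀ : S1) y₀ = arc x₀ y₀ - arc x₀ z₀ := by
      rw [arc_eq_sub x₀, if_neg (by linarith)]; ring
    have hx' : arc (z₀ : S1) x₁ = arc x₀ x₁ - arc x₀ z₀ := by
      rw [arc_eq_sub x₀, if_neg (by linarith)]; ring
    rcases h₁.lt_or_eq with h | h
    · exact hs.2 y₀ (sbtw_iff_arc.2 ⟨by linarith, by linarith⟩)
    · obtain rfl : z₀ = y₀ := Subtype.ext (arc_injective _ h)
      rcases h₂.lt_or_eq with h' | h'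
      · exact hs.2 x₁ (sbtw_iff_arc.2 ⟨by linarith, by linarith⟩)
      · obtain rfl : x₁ = z₁ := Subtype.ext (arc_injective _ h')
        exact hxy.not_succ hs
  · have hz : arc (z₀ : S1) z₁ = arc x₀ z₁ - arc x₀ z₀ + 1 := by
      rw [arc_eq_sub x₀, if_pos (by linarith)]
    have hy : arc (z₀ : S1) y₁ = arc x₀ y₁ - arc x₀ z₀ := by
      rw [arc_eq_sub x₀, if_neg (by linarith)]; ring
    have hx' : arc (z₀ : S1) x₀ = 1 - arc x₀ z₀ := by
      rw [arc_eq_sub x₀, arc_self, if_pos (by linarith [arc_nonneg (x₀ : S1) y₀])]; ring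
    rcases h₃.lt_or_eq with h | h
    · exact hs.2 y₁ (sbtw_iff_arc.2 ⟨by linarith, by linarith⟩)
    · obtain rfl : z₀ = y₁ := Subtype.ext (arc_injective _ h)
      rcases h₆.lt_or_eq with h' | h'
      · exact hs.2 x₀ (sbtw_iff_arc.2 ⟨by linarith, by linarith⟩)
      · obtain rfl : x₀ = z₁ := Subtype.ext (arc_eq_zero_iff.1 h'.symm)
        exact hxy.not_succ' hs

theorem _root_.IgusaTodorov.IsBefore.isParallel (h : IsBefore x₀ x₁ y₀ y₁) :
    IsParallel x₀ x₁ y₀ y₁ := by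
  have h₁ := h.lt
  have h₂ := h.le
  have h₃ := arc_nonneg (x₀ : S1) y₀
  have h₄ := arc_lt_one (x₀ : S1) y₁
  rintro (_ | _) <;>
    simp only [ends, cond_true, cond_false, Bool.not_true, Bool.not_false, cocycle_eq_zero_iff]
  · exact ⟨h₂, by linarith⟩
  · rw [arc_eq_sub x₀ x₁ x₀, arc_eq_sub x₀ x₁ y₀, arc_eq_sub x₀ x₁ y₁, arc_self,
      if_pos (by linarith), if_pos h₁, if_neg (by linarith)]
    exact ⟨by linarith, by linarith⟩

theorem exists_lead_eq_one (hx : x₀ ≠ x₁) (hy : y₀ ≠ y₁) (h : IsBefore x₀ x₁ y₀ y₁) :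
    ∃ u : M k x₀ x₁ hx ⟶ M k y₀ y₁ hy, lead u = 1 :=
  ⟨diagHom hx hy h.isParallel 1, (map_one (PowerSeries.constantCoeff (R := k)) :)⟩

/-! ### Morphisms from `M(x₀, x₁)` to a fixed object -/

/-- The arcs `[x₀, p]` and `[x₁, q]` are disjoint, since neither contains the last point of the
other, and `y₀`, `y₁` lie on them. -/
theorem isParallel_of_isFirst {S : Set S1} {p q : S1} (hpq : p ≠ q) (hx₀ : IsFirst S x₀ p)
    (hy₀ : IsFirst S y₀ p) (hx₁ : IsFirst S x₁ q) (hy₁ : IsFirst S y₁ q)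
    (h₀ : arc y₀ p ≤ arc x₀ p) (h₁ : arc y₁ q ≤ arc x₁ q) : IsParallel x₀ x₁ y₀ y₁ := by
  have key {p q : S1} {x₀ x₁ y₀ y₁ : Z} (hpq : p ≠ q) (hx₀ : IsFirst S x₀ p)
      (hx₁ : IsFirst S x₁ q) (hy₁ : IsFirst S y₁ q)
      (h₀ : arc y₀ p ≤ arc x₀ p) (h₁ : arc y₁ q ≤ arc x₁ q) :
      arc (x₀ : S1) x₁ ≤ arc x₀ y₁ ∧ arc (x₀ : S1) y₀ ≤ arc x₀ y₁ := by
    have hlt : arc x₀ p < arc x₀ q :=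
      lt_of_le_of_ne (hx₀.2 q hx₁.1) fun h => hpq (arc_injective _ h)
    have hlt₁ : arc x₁ q < arc x₁ p :=
      lt_of_le_of_ne (hx₁.2 p hx₀.1) fun h => hpq (arc_injective _ h).symm
    have hlt₂ : arc y₁ q < arc y₁ p :=
      lt_of_le_of_ne (hy₁.2 p hx₀.1) fun h => hpq (arc_injective _ h).symm
    rw [arc_eq_sub x₀ x₁ q] at h₁ hlt₁
    rw [arc_eq_sub x₀ y₁ q] at h₁ hlt₂
    rw [arc_eq_sub x₀ x₁ p] at hlt₁
    rw [arc_eq_sub x₀ y₁ p] at hlt₂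
    rw [arc_eq_sub x₀ y₀ p] at h₀
    have := arc_nonneg (x₀ : S1) p
    have := arc_nonneg (x₀ : S1) y₀
    have := arc_lt_one (x₀ : S1) y₀
    constructor
    · split_ifs at h₁ hlt₁ hlt₂ <;> linarith
    · split_ifs at h₀ hlt₂ <;> linarith
  rintro (_ | _) <;>
    simp only [ends, cond_true, cond_false, Bool.not_true, Bool.not_false, cocycle_eq_zero_iff]
  · exact key hpq hx₀ hx₁ hy₁ h₀ h₁
  · exact key hpq.symm hx₁ hx₀ hy₀ h₁ h₀

theorem cocycle_eq_zero_of_isFirst {S : Set S1} {x y p t : S1} (hx : IsFirst S x p)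
    (h : arc y p ≤ arc x p) (ht : t ∈ S) : cocycle x y t = 0 := by
  rw [cocycle_eq_zero_iff]
  refine le_trans ?_ (hx.2 t ht)
  rw [arc_eq_sub x] at h
  have := arc_nonneg x y
  have := arc_lt_one x y
  split_ifs at h <;> linarith

/-- Up to exchanging the ends, `x₁` lies between `x₀` and `p`. Then `x₀` can be moved forward to the
predecessor `w` of `x₁` without passing a point of `T`, so the morphism factors through the
projective-injective `M(w, x₁)`. -/
theorem mem_null_of_isFirst (hZ : IsAdmissible Z) {T : Frob k Z} {S : Set S1}
    (hS : ∀ j, ((T.P.X j).pt : S1) ∈ S) {p : S1} {h : x₀ ≠ x₁} (hx₀ : IsFirst S x₀ p)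
    (hx₁ : IsFirst S x₁ p) (g : M k x₀ x₁ h ⟶ T) : g ∈ null _ _ := by
  have key {x₀ x₁ : Z} (h : x₀ ≠ x₁) (hx₀ : IsFirst S x₀ p)
      (hle : arc x₁ p ≤ arc x₀ p) (g : M k x₀ x₁ h ⟶ T) : g ∈ null _ _ := by
    obtain ⟨w, hw⟩ := hZ.exists_pred x₁
    have hlt : arc x₁ p < arc x₀ p :=
      lt_of_le_of_ne hle fun h' => h (Subtype.ext (arc_left_injective _ h').symm)
    have hpos : 0 < arc (x₀ : S1) x₁ := arc_pos_iff.2 fun h' => h (Subtype.ext h')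
    have hsx := hw.2 x₀
    rw [sbtw_iff_arc] at hsx
    have hwx : arc (x₀ : S1) w ≤ arc x₀ x₁ := by
      rw [arc_eq_sub x₀ w x₀, arc_eq_sub x₀ w x₁, arc_self] at hsx
      have := arc_lt_one (x₀ : S1) w
      by_contra hc
      rw [not_le] at hc
      rw [if_pos (by linarith), if_pos hc] at hsx
      exact hsx ⟨by linarith, by linarith⟩
    have hx₁p : arc (x₀ : S1) x₁ ≤ arc x₀ p :=
      cocycle_eq_zero_iff.1 (cocycle_eq_zero_of_isFirst hx₀ hle hx₀.1)
    obtain ⟨a, b, rfl⟩ := exists_factor h hw.1 (y₀ := w) (y₁ := x₁) (T := T) (by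
      rintro (_ | _) <;>
        simp only [ends, cond_true, cond_false, Bool.not_true, Bool.not_false, cocycle_eq_zero_iff,
          cocycle_self_left, and_true]
      · exact ⟨le_rfl, hwx⟩
      · rw [arc_eq_sub x₀ x₁ x₀, arc_eq_sub x₀ x₁ w, arc_self, if_pos hpos]
        have : arc (x₀ : S1) w < arc x₀ x₁ :=
          lt_of_le_of_ne hwx fun h' => hw.1 (Subtype.ext (arc_injective _ h'))
        rw [if_pos this]
        linarith [arc_nonneg (x₀ : S1) w]) (by
      rintro (_ | _) j <;>
        simp only [ends, cond_true, cond_false, cocycle_eq_zero_iff, arc_self]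
      · exact hwx.trans (hx₁p.trans (hx₀.2 _ (hS j)))
      · exact arc_nonneg _ _) g
    exact AddSubgroup.subset_closure ⟨w, x₁, hw, a, b, rfl⟩
  rcases le_total (arc x₁ p) (arc x₀ p) with hle | hle
  · exact key h hx₀ hle g
  · rw [← swapHom_comp_swapHom h g]
    exact comp_mem_null _ (key h.symm hx₁ hle _)

/-- Finitely many morphisms generate all morphisms `M(x₀, x₁) ⟶ T`. -/
theorem exists_finite_generators (h : x₀ ≠ x₁) (T : Frob k Z) :
    ∃ G : Set (M k x₀ x₁ h ⟶ T), G.Finite ∧ ∀ P : (M k x₀ x₁ h ⟶ T) → Prop, P 0 →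
      (∀ u v, P u → P v → P (u + v)) → (∀ (a : M k x₀ x₁ h ⟶ M k x₀ x₁ h) (u), P u → P (a ≫ u)) →
      (∀ u ∈ G, P u) → ∀ g, P g := by
  let N : Submodule (PowerSeries k) (Bool → T.P.ι → PowerSeries k) :=
    { carrier := {φ | IsHomMatrix x₀ x₁ T φ}
      zero_mem' := fun i j => by simp
      add_mem' := fun {φ ψ} hφ hψ i j => by
        simp only [Pi.add_apply, add_mul, mul_add, Finset.sum_add_distrib]
        rw [hφ i j, hψ i j]
      smul_mem' := fun r φ hφ i j => by
        have := congrArg (r * ·) (hφ i j)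
        simp only [Finset.mul_sum] at this
        simp only [Pi.smul_apply, smul_eq_mul]
        rw [mul_left_comm, this]
        exact Finset.sum_congr rfl fun l _ => by ring }
  obtain ⟨s, hs⟩ := IsNoetherian.noetherian N
  have hsN : ∀ φ ∈ s, IsHomMatrix x₀ x₁ T φ := fun φ hφ =>
    show φ ∈ N from hs ▸ Submodule.subset_span hφ
  refine ⟨Set.range fun φ : s => ofMatrix h φ.1 (hsN φ.1 φ.2), Set.finite_range _, ?_⟩
  intro P h₀ hadd hcomp hG g
  have key : ∀ φ ∈ Submodule.span (PowerSeries k) (s : Set (Bool → T.P.ι → PowerSeries k)),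
      ∀ hφ : IsHomMatrix x₀ x₁ T φ, P (ofMatrix h φ hφ) := by
    intro φ hφ
    induction hφ using Submodule.span_induction with
    | mem φ hφ => exact fun _ => hG _ ⟨⟨φ, hφ⟩, rfl⟩
    | zero => exact fun _ => h₀
    | add φ ψ hφ hψ ihφ ihψ =>
      rw [hs] at hφ hψ
      exact fun _ => hadd _ _ (ihφ hφ) (ihψ hψ)
    | smul r φ hφ ih =>
      rw [hs] at hφ
      intro hr
      -- Scalars act through endomorphisms of the source, so closure under precomposition covers
      -- them.
      convert hcomp (diagHom h h (IsParallel.refl x₀ x₁) r) _ (ih hφ) using 1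
      refine mat_ext fun i j => ?_
      rw [mat_diagHom_comp, cocycle_self_left, pow_zero, one_mul]
      rfl
  refine key (mat g) ?_ (isHomMatrix_mat g)
  rw [hs]
  exact isHomMatrix_mat g

/-! ### Biproducts -/

/-- The direct sum of two matrix objects. -/
abbrev sumP (P Q : Mat_ (Pt k Z)) : Mat_ (Pt k Z) := ⟨P.ι ⊕ Q.ι, Sum.elim P.X Q.X⟩

/-- The block diagonal matrix with two given blocks. -/
def sumD {P Q : Mat_ (Pt k Z)} (f : P ⟶ P) (g : Q ⟶ Q) : sumP P Q ⟶ sumP P Q := fun i j =>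
  match i, j with
  | .inl i, .inl j => f i j
  | .inr i, .inr j => g i j
  | .inl _, .inr _ => (0 : PowerSeries k)
  | .inr _, .inl _ => (0 : PowerSeries k)

/-- The first inclusion. -/
def sumInl (P Q : Mat_ (Pt k Z)) : P ⟶ sumP P Q := fun i j =>
  match j with
  | .inl j => (𝟙 P : P ⟶ P) i j
  | .inr _ => (0 : PowerSeries k)

/-- The second inclusion. -/
def sumInr (P Q : Mat_ (Pt k Z)) : Q ⟶ sumP P Q := fun i j =>
  match j with
  | .inl _ => (0 : PowerSeries k)
  | .inr j => (𝟙 Q : Q ⟶ Q) i j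

/-- The first projection. -/
def sumFst (P Q : Mat_ (Pt k Z)) : sumP P Q ⟶ P := fun i j =>
  match i with
  | .inl i => (𝟙 P : P ⟶ P) i j
  | .inr _ => (0 : PowerSeries k)

/-- The second projection. -/
def sumSnd (P Q : Mat_ (Pt k Z)) : sumP P Q ⟶ Q := fun i j =>
  match i with
  | .inl _ => (0 : PowerSeries k)
  | .inr i => (𝟙 Q : Q ⟶ Q) i j

variable {P Q R : Mat_ (Pt k Z)}

theorem entry_sumFst_comp_inl (f : P ⟶ R) (i : P.ι) (j : R.ι) :
    entry (sumFst P Q ≫ f) (.inl i) j = entry f i j := by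
  rw [entry_comp]
  exact (entry_comp (𝟙 P) f i j).symm.trans (by rw [Category.id_comp])

theorem entry_sumFst_comp_inr (f : P ⟶ R) (i : Q.ι) (j : R.ι) :
    entry (sumFst P Q ≫ f) (.inr i) j = 0 := by
  rw [entry_comp]
  exact Finset.sum_eq_zero fun l _ => (congrArg _ (zero_mul _)).trans (mul_zero _)

theorem entry_sumSnd_comp_inr (f : Q ⟶ R) (i : Q.ι) (j : R.ι) :
    entry (sumSnd P Q ≫ f) (.inr i) j = entry f i j := by
  rw [entry_comp]
  exact (entry_comp (𝟙 Q) f i j).symm.trans (by rw [Category.id_comp])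

theorem entry_sumSnd_comp_inl (f : Q ⟶ R) (i : P.ι) (j : R.ι) :
    entry (sumSnd P Q ≫ f) (.inl i) j = 0 := by
  rw [entry_comp]
  exact Finset.sum_eq_zero fun l _ => (congrArg _ (zero_mul _)).trans (mul_zero _)

theorem entry_comp_sumInl_inl (f : R ⟶ P) (i : R.ι) (j : P.ι) :
    entry (f ≫ sumInl P Q) i (.inl j) = entry f i j := by
  rw [entry_comp]
  exact (entry_comp f (𝟙 P) i j).symm.trans (by rw [Category.comp_id])

theorem entry_comp_sumInl_inr (f : R ⟶ P) (i : R.ι) (j : Q.ι) :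
    entry (f ≫ sumInl P Q) i (.inr j) = 0 := by
  rw [entry_comp]
  exact Finset.sum_eq_zero fun l _ => (congrArg _ (mul_zero _)).trans (mul_zero _)

theorem entry_comp_sumInr_inr (f : R ⟶ Q) (i : R.ι) (j : Q.ι) :
    entry (f ≫ sumInr P Q) i (.inr j) = entry f i j := by
  rw [entry_comp]
  exact (entry_comp f (𝟙 Q) i j).symm.trans (by rw [Category.comp_id])

theorem entry_comp_sumInr_inl (f : R ⟶ Q) (i : R.ι) (j : P.ι) :
    entry (f ≫ sumInr P Q) i (.inl j) = 0 := by
  rw [entry_comp]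
  exact Finset.sum_eq_zero fun l _ => (congrArg _ (mul_zero _)).trans (mul_zero _)

theorem entry_comp_sumFst (f : R ⟶ sumP P Q) (i : R.ι) (j : P.ι) :
    entry (f ≫ sumFst P Q) i j = entry f i (.inl j) := by
  rw [entry_comp]
  refine (Fintype.sum_sum_type _).trans ?_
  let g : R ⟶ P := fun i j => f i (.inl j)
  have h := entry_comp g (𝟙 P) i j
  rw [Category.comp_id] at h
  refine Eq.trans ?_ h.symm
  refine (congrArg₂ (· + ·) (Eq.refl _) (Finset.sum_eq_zero fun l _ => ?_)).trans (add_zero _)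
  exact (congrArg _ (mul_zero _)).trans (mul_zero _)

theorem entry_comp_sumSnd (f : R ⟶ sumP P Q) (i : R.ι) (j : Q.ι) :
    entry (f ≫ sumSnd P Q) i j = entry f i (.inr j) := by
  rw [entry_comp]
  refine (Fintype.sum_sum_type _).trans ?_
  let g : R ⟶ Q := fun i j => f i (.inr j)
  have h := entry_comp g (𝟙 Q) i j
  rw [Category.comp_id] at h
  refine Eq.trans ?_ h.symm
  refine (congrArg₂ (· + ·) (Finset.sum_eq_zero fun l _ => ?_) (Eq.refl _)).trans (zero_add _)
  exact (congrArg _ (mul_zero _)).trans (mul_zero _)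

theorem sumInl_sumFst : sumInl P Q ≫ sumFst P Q = 𝟙 P :=
  entry_ext fun i j => entry_comp_sumFst (sumInl P Q) i j

theorem sumInr_sumSnd : sumInr P Q ≫ sumSnd P Q = 𝟙 Q :=
  entry_ext fun i j => entry_comp_sumSnd (sumInr P Q) i j

theorem sumInl_sumSnd : sumInl P Q ≫ sumSnd P Q = 0 :=
  entry_ext fun i j => entry_comp_sumSnd (sumInl P Q) i j

theorem sumInr_sumFst : sumInr P Q ≫ sumFst P Q = 0 :=
  entry_ext fun i j => entry_comp_sumFst (sumInr P Q) i j

theorem sumD_eq (f : P ⟶ P) (g : Q ⟶ Q) :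
    sumD f g = sumFst P Q ≫ f ≫ sumInl P Q + sumSnd P Q ≫ g ≫ sumInr P Q := by
  refine entry_ext ?_
  rintro (i | i) (j | j) <;> rw [entry_add]
  · rw [entry_sumFst_comp_inl, entry_sumSnd_comp_inl, entry_comp_sumInl_inl, add_zero]; rfl
  · rw [entry_sumFst_comp_inl, entry_sumSnd_comp_inl, entry_comp_sumInl_inr, add_zero]; rfl
  · rw [entry_sumFst_comp_inr, entry_sumSnd_comp_inr, entry_comp_sumInr_inl, add_zero]; rfl
  · rw [entry_sumFst_comp_inr, entry_sumSnd_comp_inr, entry_comp_sumInr_inr, zero_add]; rfl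

theorem sum_total : sumFst P Q ≫ sumInl P Q + sumSnd P Q ≫ sumInr P Q = 𝟙 (sumP P Q) := by
  refine entry_ext ?_
  rintro (i | i) (j | j) <;> rw [entry_add]
  · rw [entry_sumFst_comp_inl, entry_sumSnd_comp_inl, add_zero]
    change (𝟙 P : P ⟶ P) i j = (𝟙 (sumP P Q) : sumP P Q ⟶ sumP P Q) (.inl i) (.inl j)
    by_cases h : i = j
    · subst h
      rw [Mat_.id_apply_self, Mat_.id_apply_self]
      rfl
    · rw [Mat_.id_apply_of_ne _ _ _ h, Mat_.id_apply_of_ne _ _ _ (by simpa using h)]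
  · rw [entry_sumFst_comp_inl, entry_sumSnd_comp_inl, add_zero]
    exact (Mat_.id_apply_of_ne (sumP P Q) (.inl i) (.inr j) (by simp)).symm
  · rw [entry_sumFst_comp_inr, entry_sumSnd_comp_inr, zero_add]
    exact (Mat_.id_apply_of_ne (sumP P Q) (.inr i) (.inl j) (by simp)).symm
  · rw [entry_sumFst_comp_inr, entry_sumSnd_comp_inr, zero_add]
    change (𝟙 Q : Q ⟶ Q) i j = (𝟙 (sumP P Q) : sumP P Q ⟶ sumP P Q) (.inr i) (.inr j)
    by_cases h : i = j
    · subst h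
      rw [Mat_.id_apply_self, Mat_.id_apply_self]
      rfl
    · rw [Mat_.id_apply_of_ne _ _ _ h, Mat_.id_apply_of_ne _ _ _ (by simpa using h)]

theorem sumInl_sumD (f : P ⟶ P) (g : Q ⟶ Q) : sumInl P Q ≫ sumD f g = f ≫ sumInl P Q := by
  rw [sumD_eq, Preadditive.comp_add, ← Category.assoc, ← Category.assoc (sumInl P Q) (sumSnd P Q),
    sumInl_sumFst, sumInl_sumSnd, Category.id_comp, zero_comp, add_zero]

theorem sumInr_sumD (f : P ⟶ P) (g : Q ⟶ Q) : sumInr P Q ≫ sumD f g = g ≫ sumInr P Q := by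
  rw [sumD_eq, Preadditive.comp_add, ← Category.assoc, ← Category.assoc (sumInr P Q) (sumSnd P Q),
    sumInr_sumFst, sumInr_sumSnd, Category.id_comp, zero_comp, zero_add]

theorem sumD_sumFst (f : P ⟶ P) (g : Q ⟶ Q) : sumD f g ≫ sumFst P Q = sumFst P Q ≫ f := by
  rw [sumD_eq, Preadditive.add_comp, Category.assoc, Category.assoc, Category.assoc, Category.assoc,
    sumInl_sumFst, sumInr_sumFst, Category.comp_id, comp_zero, comp_zero, add_zero]

theorem sumD_sumSnd (f : P ⟶ P) (g : Q ⟶ Q) : sumD f g ≫ sumSnd P Q = sumSnd P Q ≫ g := by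
  rw [sumD_eq, Preadditive.add_comp, Category.assoc, Category.assoc, Category.assoc, Category.assoc,
    sumInl_sumSnd, sumInr_sumSnd, Category.comp_id, comp_zero, comp_zero, zero_add]

theorem sumD_comp (f f' : P ⟶ P) (g g' : Q ⟶ Q) :
    sumD f g ≫ sumD f' g' = sumD (f ≫ f') (g ≫ g') := by
  rw [sumD_eq f g, Preadditive.add_comp, Category.assoc, Category.assoc, Category.assoc,
    Category.assoc, sumInl_sumD, sumInr_sumD, sumD_eq, Category.assoc, Category.assoc]

theorem sumD_id : sumD (𝟙 P) (𝟙 Q) = 𝟙 (sumP P Q) := by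
  rw [sumD_eq, Category.id_comp, Category.id_comp, sum_total]

/-- The direct sum of two objects of the Frobenius category. -/
def sum (A B : Frob k Z) : Frob k Z where
  P := sumP A.P B.P
  d := sumD A.d B.d
  d_sq i j := by
    rw [sumD_comp, ← sumD_id]
    rcases i with i | i <;> rcases j with j | j
    · exact A.d_sq i j
    · exact (smul_zero (PowerSeries.X : PowerSeries k)).symm
    · exact (smul_zero (PowerSeries.X : PowerSeries k)).symm
    · exact B.d_sq i j
  twisted i j w hw := by
    rcases i with i | i <;> rcases j with j | j
    · exact A.twisted i j w hw
    · exact ⟨0, (comp_zero (f := gen (A.P.X i) w) (Z := B.P.X j)).symm⟩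
    · exact ⟨0, (comp_zero (f := gen (B.P.X i) w) (Z := A.P.X j)).symm⟩
    · exact B.twisted i j w hw

instance : HasBinaryBiproducts (Frob k Z) where
  has_binary_biproduct A B := by
    let b : BinaryBicone A B :=
      { pt := sum A B
        fst := ⟨sumFst A.P B.P, sumD_sumFst A.d B.d⟩
        snd := ⟨sumSnd A.P B.P, sumD_sumSnd A.d B.d⟩
        inl := ⟨sumInl A.P B.P, (sumInl_sumD A.d B.d).symm⟩
        inr := ⟨sumInr A.P B.P, (sumInr_sumD A.d B.d).symm⟩
        inl_fst := hom_ext sumInl_sumFst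
        inl_snd := hom_ext sumInl_sumSnd
        inr_fst := hom_ext sumInr_sumFst
        inr_snd := hom_ext sumInr_sumSnd }
    exact (hasBinaryBiproduct_of_total b (hom_ext sum_total))

variable (k Z) in
/-- The zero object of the Frobenius category. -/
def zeroObj : Frob k Z where
  P := ⟨Empty, Empty.elim⟩
  d := 0
  d_sq i := i.elim
  twisted i := i.elim

instance : HasZeroObject (Frob k Z) :=
  ⟨zeroObj k Z, (IsZero.iff_id_eq_zero _).2 (hom_ext (Mat_.hom_ext _ _ fun i => i.elim))⟩

instance : HasFiniteBiproducts (Frob k Z) :=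
  have : HasTerminal (Frob k Z) := HasZeroObject.hasTerminal
  have : HasFiniteProducts (Frob k Z) := hasFiniteProducts_of_has_binary_and_terminal
  HasFiniteBiproducts.of_hasFiniteProducts

end Frob

open Frob

variable (k Z) in
/-- The quotient functor from the Frobenius category to the cluster category. -/
abbrev toCluster : Frob k Z ⥤ ClusterCat k Z := Quotient.functor _

instance : (toCluster k Z).Additive :=
  Quotient.functor_additive (Frob.stableRel k Z) _

theorem toCluster_map_eq_iff {A B : Frob k Z} {u v : A ⟶ B} :
    (toCluster k Z).map u = (toCluster k Z).map v ↔ u - v ∈ null A B :=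
  Quotient.functor_map_eq_iff (Frob.stableRel k Z) u v

theorem lead_eq_of_map_eq {x₀ x₁ y₀ y₁ : Z} {hx : x₀ ≠ x₁} {hy : y₀ ≠ y₁}
    (hxy : IsBefore x₀ x₁ y₀ y₁) {u v : M k x₀ x₁ hx ⟶ M k y₀ y₁ hy}
    (h : (toCluster k Z).map u = (toCluster k Z).map v) : lead u = lead v := by
  rw [← sub_eq_zero, ← map_sub]
  exact lead_eq_zero_of_mem_null hxy (toCluster_map_eq_iff.1 h)

/-! ### Additive closures -/

section

universe v u

variable {C : Type u} [Category.{v} C] [Preadditive C]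

theorem add_of_mem {S : ObjectProperty C} {U : C} (h : S U) : add S U := fun _ _ hS => hS U h

theorem add_of_isBilimit {S : ObjectProperty C} {n : ℕ} {f : Fin n → C} (b : Bicone f)
    (hb : b.IsBilimit) (h : ∀ i, S (f i)) : add S b.pt :=
  fun _ hP hS => hP.of_sum b hb fun i => hS _ (h i)

/-- The objects all of whose morphisms to `T` factor through `f`. -/
theorem isAdditiveSubcategory_factors {D T : C} (f : D ⟶ T) :
    IsAdditiveSubcategory (C := C) fun D' => ∀ g : D' ⟶ T, ∃ h : D' ⟶ D, h ≫ f = g where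
  of_iso e hS g := by
    obtain ⟨h, hh⟩ := hS (e.hom ≫ g)
    exact ⟨e.inv ≫ h, by simp [hh]⟩
  of_sum b hb hS g := by
    choose h hh using fun i => hS i (b.ι i ≫ g)
    refine ⟨∑ i, b.π i ≫ h i, ?_⟩
    rw [Preadditive.sum_comp]
    simp only [Category.assoc, hh]
    simp only [← Category.assoc]
    rw [← Preadditive.sum_comp, IsBilimit.total hb, Category.id_comp]
  of_summand b _ hS g := by
    obtain ⟨h, hh⟩ := hS (b.fst ≫ g)
    exact ⟨b.inl ≫ h, by simp [hh]⟩

/-- The objects whose morphisms to `T` lift along `f` form an additive subcategory, so testing on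
`S` is enough. -/
theorem isPrecover_add {S : ObjectProperty C} {D T : C} (hD : add S D) {f : D ⟶ T}
    (h : ∀ U, S U → ∀ g : U ⟶ T, ∃ h : U ⟶ D, h ≫ f = g) : IsPrecover (add S) f :=
  ⟨hD, fun _ g hD' => hD' _ (isAdditiveSubcategory_factors f) h g⟩

end

/-! ### Precovers from limits -/

theorem isPrecovering_of_limitsFromAbove (hZ : IsAdmissible Z) {X : Set (Sym2 Z)}
    (hX : ∀ e ∈ X, IsDiagonal Z e) (hlim : LimitsFromAbove X) : IsPrecovering (add (E k X)) := by
  intro T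
  obtain ⟨T, rfl⟩ : ∃ T', T = (toCluster k Z).obj T' := ⟨T.as, rfl⟩
  obtain ⟨z, hz⟩ := hZ.infinite.nonempty
  -- The extra point `z` keeps `S` nonempty when `T` is zero, so first points always exist.
  let S : Set S1 := insert z (Set.range fun j => ((T.P.X j).pt : S1))
  have hS : S.Finite := (Set.finite_range _).insert z
  have hSne : S.Nonempty := ⟨z, Set.mem_insert _ _⟩
  have hTS (j) : ((T.P.X j).pt : S1) ∈ S := Set.mem_insert_of_mem _ ⟨j, rfl⟩
  have hSZ : S ⊆ Z := by
    rintro _ (rfl | ⟨j, rfl⟩)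
    exacts [hz, (T.P.X j).pt.2]
  choose! F hF hFX hdom using fun (a : S1 × S1) (ha : a.1 ≠ a.2) =>
    hZ.exists_finite_dominating hlim hS hSZ ha
  let W : Set (Z × Z) := ⋃ a ∈ {a ∈ S ×ˢ S | a.1 ≠ a.2}, F a
  have hW : W.Finite := ((hS.prod hS).subset (Set.sep_subset _ _)).biUnion fun a ha => hF a ha.2
  have hWX : ∀ f ∈ W, s(f.1, f.2) ∈ X := by
    intro f hf
    obtain ⟨a, ha, hfa⟩ := Set.mem_iUnion₂.1 hf
    exact (hFX a ha.2 f hfa).1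
  have hne {x₀ x₁ : Z} (h : s(x₀, x₁) ∈ X) : x₀ ≠ x₁ := (hX _ h x₀ x₁ rfl).1
  choose G hG hgen using fun f : W => exists_finite_generators (k := k) (hne (hWX f.1 f.2)) T
  have : Finite W := hW
  have (f : W) : Finite (G f) := hG f
  obtain ⟨n, ⟨e⟩⟩ := Finite.exists_equiv_fin (Σ f : W, G f)
  let m (i : Fin n) : Frob k Z := M k _ _ (hne (hWX (e.symm i).1.1 (e.symm i).1.2))
  let g (i : Fin n) : m i ⟶ T := (e.symm i).2.1
  refine ⟨_, (toCluster k Z).map (biproduct.desc g), isPrecover_add ?_ ?_⟩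
  · exact add_of_isBilimit ((toCluster k Z).mapBicone (biproduct.bicone m))
      (isBilimitOfPreserves _ (biproduct.isBilimit m)) fun i =>
        ⟨_, _, hne (hWX _ (e.symm i).1.2), hWX _ (e.symm i).1.2, rfl⟩
  · rintro _ ⟨x₀, x₁, hx, hxX, rfl⟩ u
    obtain ⟨u, rfl⟩ := (toCluster k Z).map_surjective u
    obtain ⟨p, hp⟩ := exists_isFirst hS hSne x₀
    obtain ⟨q, hq⟩ := exists_isFirst hS hSne x₁
    by_cases hpq : p = q
    · subst hpq
      refine ⟨0, ?_⟩
      rw [zero_comp, ← (toCluster k Z).map_zero, toCluster_map_eq_iff, zero_sub]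
      exact neg_mem (mem_null_of_isFirst hZ hTS hp hq u)
    · obtain ⟨f, hf, h₀, h₁⟩ := hdom (p, q) hpq x₀ x₁ hxX hp hq
      obtain ⟨hfX, hf₀, hf₁⟩ := hFX (p, q) hpq f hf
      have hfW : f ∈ W := Set.mem_iUnion₂.2 ⟨(p, q), ⟨⟨hp.1, hq.1⟩, hpq⟩, hf⟩
      obtain ⟨a, b, rfl⟩ := exists_factor hx (hne hfX)
        (isParallel_of_isFirst hpq hp hf₀ hq hf₁ h₀ h₁) (T := T) (by
          rintro (_ | _) j
          · exact cocycle_eq_zero_of_isFirst hp h₀ (hTS j)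
          · exact cocycle_eq_zero_of_isFirst hq h₁ (hTS j)) u
      -- Morphisms that lift to the direct sum are closed under addition and precomposition, and
      -- each generator is itself a component of `biproduct.desc g`.
      obtain ⟨c, rfl⟩ : ∃ c, c ≫ biproduct.desc g = b := by
        refine hgen ⟨f, hfW⟩ (fun b => ∃ c, c ≫ biproduct.desc g = b) ⟨0, zero_comp⟩ ?_ ?_ ?_ b
        · rintro _ _ ⟨c, rfl⟩ ⟨c', rfl⟩
          exact ⟨c + c', Preadditive.add_comp _ _ _ _ _ _⟩
        · rintro a _ ⟨c, rfl⟩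
          exact ⟨a ≫ c, Category.assoc _ _ _⟩
        · intro v hv
          have key : ∀ w : Σ f : W, G f, ∃ c, c ≫ biproduct.desc g = w.2.1 := by
            intro w
            obtain ⟨i, rfl⟩ := e.symm.surjective w
            exact ⟨biproduct.ι m i, biproduct.ι_desc g i⟩
          exact key ⟨⟨f, hfW⟩, ⟨v, hv⟩⟩
      refine ⟨(toCluster k Z).map (a ≫ c), ?_⟩
      rw [← Functor.map_comp, Category.assoc]

/-! ### Limits from precovers -/

/-- Morphisms to `M(y₀, y₁)` whose leading coefficient does not vanish, and which factor through a
given object of the additive closure, factor through finitely many diagonals. -/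
theorem isAdditiveSubcategory_dominated (X : Set (Sym2 Z)) {y₀ y₁ : Z} (hy : y₀ ≠ y₁) :
    IsAdditiveSubcategory (C := ClusterCat k Z) fun D =>
      ∀ g : D ⟶ (toCluster k Z).obj (M k y₀ y₁ hy), ∃ F : Set (Z × Z), F.Finite ∧
        (∀ f ∈ F, s(f.1, f.2) ∈ X) ∧ ∀ (x₀ x₁ : Z) (hx : x₀ ≠ x₁), IsBefore x₀ x₁ y₀ y₁ →
          ∀ (h : (toCluster k Z).obj (M k x₀ x₁ hx) ⟶ D) (u : M k x₀ x₁ hx ⟶ M k y₀ y₁ hy),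
            (toCluster k Z).map u = h ≫ g → lead u ≠ 0 →
              ∃ f ∈ F, arc x₀ f.1 ≤ arc x₀ y₀ ∧ arc x₁ f.2 ≤ arc x₁ y₁ where
  of_iso e hS g := by
    obtain ⟨F, h₁, h₂, h₃⟩ := hS (e.hom ≫ g)
    exact ⟨F, h₁, h₂, fun x₀ x₁ hx hxy h u hu => h₃ x₀ x₁ hx hxy (h ≫ e.inv) u (by simp [hu])⟩
  of_sum b hb hS g := by
    choose F h₁ h₂ h₃ using fun i => hS i (b.ι i ≫ g)
    refine ⟨⋃ i, F i, Set.finite_iUnion h₁, fun f hf => ?_, fun x₀ x₁ hx hxy h u hu hne => ?_⟩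
    · obtain ⟨i, hi⟩ := Set.mem_iUnion.1 hf
      exact h₂ i f hi
    · choose v hv using fun i => (toCluster k Z).map_surjective ((h ≫ b.π i) ≫ b.ι i ≫ g)
      -- The leading coefficient is additive and stably invariant, so some summand has a nonzero
      -- one.
      have hsum : (toCluster k Z).map u = (toCluster k Z).map (∑ i, v i) := by
        rw [Functor.map_sum, hu]
        simp only [hv, Category.assoc]
        rw [← Preadditive.comp_sum]
        simp only [← Category.assoc]
        rw [← Preadditive.sum_comp, IsBilimit.total hb, Category.id_comp]
      rw [lead_eq_of_map_eq hxy hsum, map_sum] at hne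
      obtain ⟨i, -, hi⟩ := Finset.exists_ne_zero_of_sum_ne_zero hne
      obtain ⟨f, hf, hf'⟩ := h₃ i x₀ x₁ hx hxy (h ≫ b.π i) (v i) (hv i) hi
      exact ⟨f, Set.mem_iUnion.2 ⟨i, hf⟩, hf'⟩
  of_summand b _ hS g := by
    obtain ⟨F, h₁, h₂, h₃⟩ := hS (b.fst ≫ g)
    exact ⟨F, h₁, h₂, fun x₀ x₁ hx hxy h u hu => h₃ x₀ x₁ hx hxy (h ≫ b.inl) u (by simp [hu])⟩

theorem exists_finite_dominating_of_add {X : Set (Sym2 Z)} {D : ClusterCat k Z}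
    (hD : add (E k X) D) {y₀ y₁ : Z} {hy : y₀ ≠ y₁}
    (g : D ⟶ (toCluster k Z).obj (M k y₀ y₁ hy)) : ∃ F : Set (Z × Z), F.Finite ∧
      (∀ f ∈ F, s(f.1, f.2) ∈ X) ∧ ∀ (x₀ x₁ : Z) (hx : x₀ ≠ x₁), IsBefore x₀ x₁ y₀ y₁ →
        ∀ (h : (toCluster k Z).obj (M k x₀ x₁ hx) ⟶ D) (u : M k x₀ x₁ hx ⟶ M k y₀ y₁ hy),
          (toCluster k Z).map u = h ≫ g → lead u ≠ 0 →
            ∃ f ∈ F, arc x₀ f.1 ≤ arc x₀ y₀ ∧ arc x₁ f.2 ≤ arc x₁ y₁ := by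
  refine hD _ (isAdditiveSubcategory_dominated X hy) ?_ g
  rintro _ ⟨z₀, z₁, hz, hzX, rfl⟩ g
  -- Either end of the diagonal may be the one between `x₀` and `y₀`, so both orders are kept.
  refine ⟨{(z₀, z₁), (z₁, z₀)}, by simp, ?_, ?_⟩
  · rintro _ (rfl | rfl)
    exacts [hzX, Sym2.eq_swap ▸ hzX]
  · intro x₀ x₁ hx hxy h u hu hne
    obtain ⟨g, rfl⟩ := (toCluster k Z).map_surjective g
    obtain ⟨h, rfl⟩ := (toCluster k Z).map_surjective h
    rw [← Functor.map_comp] at hu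
    rw [lead_eq_of_map_eq hxy hu] at hne
    obtain ⟨b, h₁, h₂, h₃⟩ := lead_comp_ne_zero hxy hne
    refine ⟨(ends z₀ z₁ b, ends z₀ z₁ !b), ?_, h₁, ?_⟩
    · cases b
      exacts [Or.inl rfl, Or.inr rfl]
    · rw [arc_eq_sub x₀, arc_eq_sub x₀ x₁ y₁, if_neg (not_lt.2 h₂), if_neg (not_lt.2 hxy.le)]
      change arc x₀ (ends z₀ z₁ !b) - _ + _ ≤ _
      linarith

theorem limitsFromAbove_of_isPrecovering (hZ : IsAdmissible Z) {X : Set (Sym2 Z)}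
    (hX : ∀ e ∈ X, IsDiagonal Z e) (hpre : IsPrecovering (add (E k X))) : LimitsFromAbove X := by
  intro p q hpq hlim
  have key (ε : ℝ) (hε : 0 < ε) : ∃ f : Z × Z, s(f.1, f.2) ∈ X ∧ arc p f.1 < ε ∧ arc q f.2 < ε := by
    have hpZ : p ∈ closure Z := map_mem_closure continuous_fst hlim (by
      rintro _ ⟨x₀, x₁, -, rfl⟩
      exact x₀.2)
    have hqZ : q ∈ closure Z := map_mem_closure continuous_snd hlim (by
      rintro _ ⟨x₀, x₁, -, rfl⟩
      exact x₁.2)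
    have h₁ := arc_pos_iff.2 hpq
    have h₂ := arc_pos_iff.2 hpq.symm
    -- The bounds by both arcs between `p` and `q` are what `eventually_isBefore` requires.
    obtain ⟨δ, hδ, hδε, hδ₁, hδ₂⟩ : ∃ δ > 0, δ ≤ ε ∧ 2 * δ < arc p q ∧ 2 * δ < arc q p := by
      refine ⟨min ε (min (arc p q) (arc q p) / 4), by positivity, min_le_left _ _, ?_, ?_⟩
      · have := min_le_right ε (min (arc p q) (arc q p) / 4)
        have := min_le_left (arc p q) (arc q p)
        linarith
      · have := min_le_right ε (min (arc p q) (arc q p) / 4)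
        have := min_le_right (arc p q) (arc q p)
        linarith
    obtain ⟨y₀, hy₀⟩ := hZ.exists_isCloseAbove hpZ hδ
    obtain ⟨y₁, hy₁⟩ := hZ.exists_isCloseAbove hqZ hδ
    have hev := hy₀.eventually_isBefore hZ hX hy₁ hpq hδ₁ hδ₂
    have hfreq := (mem_closure_iff_frequently.1 hlim).and_eventually hev
    have hy : y₀ ≠ y₁ := by
      obtain ⟨_, ⟨x₀, x₁, hx, rfl⟩, h⟩ := hfreq.exists
      have hb := h x₀ x₁ hx rfl
      rintro rfl
      exact absurd hb.lt (not_lt.2 hb.le)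
    obtain ⟨D, g, hD, hg⟩ := hpre ((toCluster k Z).obj (M k y₀ y₁ hy))
    obtain ⟨F, hF, hFX, hdom⟩ := exists_finite_dominating_of_add hD g
    have hdom' : ∃ᶠ a in 𝓝 (p, q), ∃ f ∈ F, ∃ x : Z × Z, a = ((x.1 : S1), (x.2 : S1)) ∧
        arc (x.1 : S1) f.1 ≤ arc x.1 y₀ ∧ arc (x.2 : S1) f.2 ≤ arc x.2 y₁ := by
      refine hfreq.mono ?_
      rintro _ ⟨⟨x₀, x₁, hx, rfl⟩, h⟩
      have hb := h x₀ x₁ hx rfl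
      have hne := (hX _ hx x₀ x₁ rfl).1
      obtain ⟨u, hu⟩ := exists_lead_eq_one (k := k) hne hy hb
      obtain ⟨v, hv⟩ := hg _ ((toCluster k Z).map u)
        (add_of_mem ⟨x₀, x₁, hne, hx, rfl⟩)
      obtain ⟨f, hf, hf'⟩ := hdom x₀ x₁ hne hb v u hv.symm (by simp [hu])
      exact ⟨f, hf, (x₀, x₁), rfl, hf'⟩
    -- Pigeonhole: `F` depends only on the precover, not on the nearby diagonal, so one `f` works
    -- arbitrarily near `(p, q)`.
    obtain ⟨f, hf, hff⟩ : ∃ f ∈ F, ∃ᶠ a in 𝓝 (p, q), ∃ x : Z × Z, a = ((x.1 : S1), (x.2 : S1)) ∧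
        arc (x.1 : S1) f.1 ≤ arc x.1 y₀ ∧ arc (x.2 : S1) f.2 ≤ arc x.2 y₁ := by
      by_contra hc
      refine hdom' ?_
      filter_upwards [(eventually_all_finite hF).2 fun f hf =>
        not_frequently.1 fun h => hc ⟨f, hf, h⟩] with a ha
      rintro ⟨f, hf, hfa⟩
      exact ha f hf hfa
    -- Pulling the neighbourhood filter back to `Z × Z` lets the two inequalities pass to the limit
    -- one coordinate at a time.
    let c : Z × Z → S1 × S1 := fun x => ((x.1 : S1), (x.2 : S1))
    have hff : ∃ᶠ x in comap c (𝓝 (p, q)),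
        arc (x.1 : S1) f.1 ≤ arc x.1 y₀ ∧ arc (x.2 : S1) f.2 ≤ arc x.2 y₁ := by
      rw [frequently_comap]
      exact hff.mono fun a ⟨x, hx, hx'⟩ => ⟨x, hx.symm, hx'⟩
    have hc : Tendsto c (comap c (𝓝 (p, q))) (𝓝 (p, q)) := tendsto_comap
    refine ⟨f, hFX f hf, ?_, ?_⟩
    · exact (hZ.arc_le_of_frequently (x := Prod.fst) ((continuous_fst.tendsto _).comp hc)
        (hff.mono fun _ h => h.1)).trans_lt (hy₀.arc_lt.trans_le hδε)
    · exact (hZ.arc_le_of_frequently (x := Prod.snd) ((continuous_snd.tendsto _).comp hc)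
        (hff.mono fun _ h => h.2)).trans_lt (hy₁.arc_lt.trans_le hδε)
  choose f hfX hf₀ hf₁ using fun n : ℕ => key (1 / ((n : ℝ) + 1)) (by positivity)
  refine ⟨fun n => (f n).1, fun n => (f n).2, hfX, ?_, ?_⟩
  · exact tendstoAbove_iff.2 (squeeze_zero (fun _ => arc_nonneg _ _) (fun n => (hf₀ n).le)
      tendsto_one_div_add_atTop_nhds_zero_nat)
  · exact tendstoAbove_iff.2 (squeeze_zero (fun _ => arc_nonneg _ _) (fun n => (hf₁ n).le)
      tendsto_one_div_add_atTop_nhds_zero_nat)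

end

end IgusaTodorov

end

theorem mainTheorem3 (k : Type*) [Field k] [IsAlgClosed k]
    (Z : Set IgusaTodorov.S1) (hZ : IgusaTodorov.IsAdmissible Z)
    (X : Set (Sym2 Z)) (hX : ∀ e ∈ X, IgusaTodorov.IsDiagonal Z e) :
    IgusaTodorov.IsPrecovering (IgusaTodorov.add (IgusaTodorov.E k X)) ↔
      IgusaTodorov.PC1 Z X ∧ IgusaTodorov.PC2 Z X := by
  rw [← IgusaTodorov.limitsFromAbove_iff]
  exact ⟨IgusaTodorov.limitsFromAbove_of_isPrecovering hZ hX,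
    IgusaTodorov.isPrecovering_of_limitsFromAbove hZ hX⟩
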